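/- **Conventions.** All Hilbert spaces are complex (and arbitrary), and $B(H,K)$ is the space of bounded operators from $H$ to $K$. Projections are orthogonal and $P^\perp=I-P$. The symbol $[\mathcal X]$ denotes the weak* closure of the linear span of a set $\mathcal X$ of operators, $\mathcal X\mathcal Y=\{XY: X\in\mathcal X, Y\in\mathcal Y\}$ and $\mathcal X^*=\{X^*:X\in\mathcal X\}$. For a set $\mathcal L$ of projections on $H$, $\mathrm{Alg}(\mathcal L)=\{T\in B(H): TL(H)\subseteq L(H)\ \forall L\in\mathcal L\}$. A set $\mathcal S$ of pairs $(P,Q)$ of projections, $P$ on $H_1$ and $Q$ on $H_2$, is a *bilattice* if it contains $(0,0),(I,0),(0,I)$ and, with $(P_1,Q_1)$ and $(P_2,Q_2)$, also contains $(P_1\wedge P_2,Q_1\vee Q_2)$ and $(P_1\vee P_2,Q_1\wedge Q_2)$. Put $\mathcal S_l=\{P:(P,Q)\in\mathcal S\}$, $\mathcal S_r=\{Q:(P,Q)\in\mathcal S\}$ and $\mathfrak M(\mathcal S)=\{T\in B(H_1,H_2): QTP=0\ \forall (P,Q)\in\mathcal S\}$. The bilattice is *commutative* if the elements of $\mathcal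 S_l$ commute with each other and so do those of $\mathcal S_r$; it is *strongly closed* if it is closed in the (product) strong operator topology. **Theorem 4.3.** Let $\mathcal S^1$ (acting on $H_1,H_2$) and $\mathcal S^2$ (acting on $K_1,K_2$) be strongly closed commutative bilattices. Let $\phi:\mathcal S^1_l\to\mathcal S^2_l$ and $\psi:\mathcal S^1_r\to\mathcal S^2_r$ be maps that preserve arbitrary suprema and infima, are continuous for the strong operator topology, and satisfy $(\phi(P),\psi(Q))\in\mathcal S^2$ for all $(P,Q)\in\mathcal S^1$; assume that $\phi\oplus\psi:(P,Q)\mapsto(\phi(P),\psi(Q))$ maps $\mathcal S^1$ onto $\mathcal S^2$. Put $\mathcal U_i=\mathfrak M(\mathcal S^i)$ and $$\mathcal V_1=\{T\in B(H_1,K_1):\phi(P)^\perp TP=0\ \forall P\in\mathcal S^1_l\},\qquad \mathcal V_2=\{T\in B(H_2,K_2):\psi(Q)TQ^\perp=0\ \forall Q\in\mathcal S^1_r\},$$ $$\mathcal W_1=\{T\in B(K_1,H_1):P^\perp T\phi(P)=0\ \forall P\in\mathcal S^1_l\},\qquad \mathcal W_2=\{T\in B(K_2,H_2):QT\psi(Q)^\perp=0\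 \forall Q\in\mathcal S^1_r\}.$$ Then $$\mathcal U_1\supseteq\mathcal W_2\,\mathcal U_2\,\mathcal V_1,\qquad \mathcal U_2=[\mathcal V_2\,\mathcal U_1\,\mathcal W_1],$$ $$\mathcal W_1\mathcal V_1\subseteq\mathrm{Alg}(\mathcal S^1_l),\qquad [\mathcal V_1\mathcal W_1]=\mathrm{Alg}(\mathcal S^2_l),$$ $$\mathcal W_2\mathcal V_2\subseteq\mathrm{Alg}(\mathcal S^1_r)^*,\qquad [\mathcal V_2\mathcal W_2]=\mathrm{Alg}(\mathcal S^2_r)^*.$$ -/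

import Mathlib

noncomputable section

/-- The set of orthogonal projections of a Hilbert space `H`. -/
structure Proj (H : Type*) [NormedAddCommGroup H] [InnerProductSpace ℂ H] [CompleteSpace H] where
  /-- the underlying bounded operator -/
  op : H →L[ℂ] H
  isStarProjection : IsStarProjection op

namespace Proj

variable {H : Type*} [NormedAddCommGroup H] [InnerProductSpace ℂ H] [CompleteSpace H]

/-- The range of a projection. -/
def ran (P : Proj H) : Submodule ℂ H := P.op.range

/-- The operator `P^⊥ = I - P`. -/
def perp (P : Proj H) : H →L[ℂ] H := 1 - P.op

theorem ran_injective : Function.Injective (ran : Proj H → Submodule ℂ H) := by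
  rintro ⟨p, hp⟩ ⟨q, hq⟩ h
  obtain ⟨_, hp'⟩ := isStarProjection_iff_eq_starProjection_range.mp hp
  obtain ⟨_, hq'⟩ := isStarProjection_iff_eq_starProjection_range.mp hq
  have h' : p.range = q.range := h
  have : p = q := by
    rw [hp', hq']
    exact Submodule.starProjection_inj.mpr h'
  subst this
  rfl

/-- Projections are ordered by inclusion of their ranges. -/
instance : PartialOrder (Proj H) := PartialOrder.lift ran ran_injective

theorem le_iff {P Q : Proj H} : P ≤ Q ↔ P.ran ≤ Q.ran := Iff.rfl

/-- The projection onto the closure of a linear subspace. -/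
def onto (M : Submodule ℂ H) : Proj H :=
  ⟨M.topologicalClosure.starProjection, isStarProjection_starProjection⟩

theorem ran_onto (M : Submodule ℂ H) : (onto M).ran = M.topologicalClosure :=
  Submodule.range_starProjection _

theorem isClosed_ran (P : Proj H) : IsClosed (P.ran : Set H) := by
  exact ContinuousLinearMap.IsIdempotentElem.isClosed_range P.isStarProjection.isIdempotentElem

theorem onto_le_iff (M : Submodule ℂ H) (P : Proj H) : onto M ≤ P ↔ M ≤ P.ran := by
  rw [le_iff, ran_onto]
  exact ⟨fun h => M.le_topologicalClosure.trans h,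
    fun h => M.topologicalClosure_minimal h P.isClosed_ran⟩

theorem onto_ran (P : Proj H) : onto P.ran = P :=
  ran_injective ((ran_onto _).trans P.isClosed_ran.submodule_topologicalClosure_eq)

/-- The projections form a complete lattice: the supremum of a family of projections is the
projection onto the closed linear span of their ranges, the infimum is the projection onto the
intersection of their ranges. -/
instance : CompleteLattice (Proj H) :=
  GaloisInsertion.liftCompleteLattice (α := Submodule ℂ H) (l := onto) (u := ran)
    (GaloisConnection.toGaloisInsertion onto_le_iff (fun P => by rw [onto_ran]))

/-- The strong operator topology on the projections of `H` (pointwise convergence on `H`). -/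
instance : TopologicalSpace (Proj H) :=
  TopologicalSpace.induced (fun P : Proj H => (P.op : H → H)) inferInstance

end Proj

section Operators

variable {H₁ H₂ H₃ : Type*}
  [NormedAddCommGroup H₁] [InnerProductSpace ℂ H₁] [CompleteSpace H₁]
  [NormedAddCommGroup H₂] [InnerProductSpace ℂ H₂] [CompleteSpace H₂]
  [NormedAddCommGroup H₃] [InnerProductSpace ℂ H₃] [CompleteSpace H₃]

/-- The weak* (ultraweak) topology of `B(H₁, H₂)`: the weakest topology for which the functionals
`T ↦ ∑ₙ ⟪y n, T (x n)⟫`, with `∑ₙ ‖x n‖² < ∞` and `∑ₙ ‖y n‖² < ∞`, are continuous. These are the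
functionals `T ↦ tr (T A)` with `A : H₂ → H₁` of trace class. -/
abbrev weakStarTopology (H₁ H₂ : Type*)
    [NormedAddCommGroup H₁] [InnerProductSpace ℂ H₁] [CompleteSpace H₁]
    [NormedAddCommGroup H₂] [InnerProductSpace ℂ H₂] [CompleteSpace H₂] :
    TopologicalSpace (H₁ →L[ℂ] H₂) :=
  TopologicalSpace.induced
    (fun (T : H₁ →L[ℂ] H₂)
      (p : {p : (ℕ → H₁) × (ℕ → H₂) //
        Summable (fun n => ‖p.1 n‖ ^ 2) ∧ Summable (fun n => ‖p.2 n‖ ^ 2)}) =>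
      ∑' n, inner ℂ (p.1.2 n) (T (p.1.1 n)))
    inferInstance

/-- `[𝒳]`: the weak* closure of the linear span of a set of operators. -/
def wkSpan (𝒳 : Set (H₁ →L[ℂ] H₂)) : Set (H₁ →L[ℂ] H₂) :=
  @closure _ (weakStarTopology H₁ H₂) (Submodule.span ℂ 𝒳 : Set (H₁ →L[ℂ] H₂))

/-- The set `𝒳𝒴` of all products `XY` with `X ∈ 𝒳` and `Y ∈ 𝒴`. -/
def opMul (𝒳 : Set (H₂ →L[ℂ] H₃)) (𝒴 : Set (H₁ →L[ℂ] H₂)) : Set (H₁ →L[ℂ] H₃) :=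
  {T | ∃ X ∈ 𝒳, ∃ Y ∈ 𝒴, T = X ∘L Y}

/-- `𝒳* = {X* : X ∈ 𝒳}`. -/
def opAdj (𝒳 : Set (H₁ →L[ℂ] H₂)) : Set (H₂ →L[ℂ] H₁) :=
  ContinuousLinearMap.adjoint '' 𝒳

/-- `Alg(𝓛) = {T : T(L(H)) ⊆ L(H) for all L ∈ 𝓛}`. -/
def Alg (𝓛 : Set (Proj H₁)) : Set (H₁ →L[ℂ] H₁) :=
  {T | ∀ L ∈ 𝓛, ∀ x ∈ L.ran, T x ∈ L.ran}

end Operators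

section Bilattices

variable {H₁ H₂ K₁ K₂ : Type*}
  [NormedAddCommGroup H₁] [InnerProductSpace ℂ H₁] [CompleteSpace H₁]
  [NormedAddCommGroup H₂] [InnerProductSpace ℂ H₂] [CompleteSpace H₂]
  [NormedAddCommGroup K₁] [InnerProductSpace ℂ K₁] [CompleteSpace K₁]
  [NormedAddCommGroup K₂] [InnerProductSpace ℂ K₂] [CompleteSpace K₂]

/-- Bilattices of projections. -/
structure IsBilattice (S : Set (Proj H₁ × Proj H₂)) : Prop where
  bot_bot_mem : (⊥, ⊥) ∈ S
  top_bot_mem : (⊤, ⊥) ∈ S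
  bot_top_mem : (⊥, ⊤) ∈ S
  inf_sup_mem : ∀ p ∈ S, ∀ q ∈ S, (p.1 ⊓ q.1, p.2 ⊔ q.2) ∈ S
  sup_inf_mem : ∀ p ∈ S, ∀ q ∈ S, (p.1 ⊔ q.1, p.2 ⊓ q.2) ∈ S

/-- `S_l = {P : (P, Q) ∈ S}`. -/
def leftSet (S : Set (Proj H₁ × Proj H₂)) : Set (Proj H₁) := {P | ∃ Q, (P, Q) ∈ S}

/-- `S_r = {Q : (P, Q) ∈ S}`. -/
def rightSet (S : Set (Proj H₁ × Proj H₂)) : Set (Proj H₂) := {Q | ∃ P, (P, Q) ∈ S}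

/-- A bilattice `S` such that the elements of `S_l` commute with each other, the elements of `S_r`
commute with each other, and `S` is closed in the strong operator topology. -/
structure IsStronglyClosedCommBilattice (S : Set (Proj H₁ × Proj H₂)) : Prop
    extends IsBilattice S where
  comm_left : ∀ P ∈ leftSet S, ∀ P' ∈ leftSet S, Commute P.op P'.op
  comm_right : ∀ Q ∈ rightSet S, ∀ Q' ∈ rightSet S, Commute Q.op Q'.op
  isClosed : IsClosed S

/-- `𝔐(S) = {T ∈ B(H₁, H₂) : QTP = 0 for all (P, Q) ∈ S}`. -/
def bilatticeSpace (S : Set (Proj H₁ × Proj H₂)) : Set (H₁ →L[ℂ] H₂) :=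
  {T | ∀ p ∈ S, p.2.op ∘L T ∘L p.1.op = 0}

/-- A map `θ` between sets of projections preserves arbitrary suprema and infima: whenever the
supremum (infimum), taken among all projections, of a family in `L₁` belongs to `L₁`, the map `θ`
sends it to the supremum (infimum) of the image family. (If `L₁` is a commutative subspace lattice,
then the supremum and the infimum of each family in `L₁` belong to `L₁`.) -/
structure IsCSLHom {L₁ : Set (Proj H₁)} {L₂ : Set (Proj K₁)} (θ : L₁ → L₂) : Prop where
  map_sSup : ∀ (A : Set L₁) (P : L₁),
    (P : Proj H₁) = sSup ((fun R : L₁ => (R : Proj H₁)) '' A) →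
      (θ P : Proj K₁) = sSup ((fun R : L₁ => (θ R : Proj K₁)) '' A)
  map_sInf : ∀ (A : Set L₁) (P : L₁),
    (P : Proj H₁) = sInf ((fun R : L₁ => (R : Proj H₁)) '' A) →
      (θ P : Proj K₁) = sInf ((fun R : L₁ => (θ R : Proj K₁)) '' A)

/-- `φ ⊕ ψ : S¹ → S²` is a bilattice homomorphism. -/
structure IsBilatticeHom {S₁ : Set (Proj H₁ × Proj H₂)} {S₂ : Set (Proj K₁ × Proj K₂)}
    (φ : leftSet S₁ → leftSet S₂) (ψ : rightSet S₁ → rightSet S₂) : Prop where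
  left : IsCSLHom φ
  right : IsCSLHom ψ
  map_mem : ∀ (P : leftSet S₁) (Q : rightSet S₁), ((P : Proj H₁), (Q : Proj H₂)) ∈ S₁ →
    ((φ P : Proj K₁), (ψ Q : Proj K₂)) ∈ S₂

/-- `φ ⊕ ψ` maps `S¹` onto `S²`. -/
def IsOntoBilattice {S₁ : Set (Proj H₁ × Proj H₂)} {S₂ : Set (Proj K₁ × Proj K₂)}
    (φ : leftSet S₁ → leftSet S₂) (ψ : rightSet S₁ → rightSet S₂) : Prop :=
  ∀ p ∈ S₂, ∃ (P : leftSet S₁) (Q : rightSet S₁), ((P : Proj H₁), (Q : Proj H₂)) ∈ S₁ ∧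
    (φ P : Proj K₁) = p.1 ∧ (ψ Q : Proj K₂) = p.2

variable {S₁ : Set (Proj H₁ × Proj H₂)} {S₂ : Set (Proj K₁ × Proj K₂)}

/-- `V₁ = {T : φ(P)^⊥ T P = 0 for all P ∈ S¹_l}`. -/
def spaceV₁ (φ : leftSet S₁ → leftSet S₂) : Set (H₁ →L[ℂ] K₁) :=
  {T | ∀ P : leftSet S₁, (φ P : Proj K₁).perp ∘L T ∘L (P : Proj H₁).op = 0}

/-- `V₂ = {T : ψ(Q) T Q^⊥ = 0 for all Q ∈ S¹_r}`. -/
def spaceV₂ (ψ : rightSet S₁ → rightSet S₂) : Set (H₂ →L[ℂ] K₂) :=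
  {T | ∀ Q : rightSet S₁, (ψ Q : Proj K₂).op ∘L T ∘L (Q : Proj H₂).perp = 0}

/-- `W₁ = {T : P^⊥ T φ(P) = 0 for all P ∈ S¹_l}`. -/
def spaceW₁ (φ : leftSet S₁ → leftSet S₂) : Set (K₁ →L[ℂ] H₁) :=
  {T | ∀ P : leftSet S₁, (P : Proj H₁).perp ∘L T ∘L (φ P : Proj K₁).op = 0}

/-- `W₂ = {T : Q T ψ(Q)^⊥ = 0 for all Q ∈ S¹_r}`. -/
def spaceW₂ (ψ : rightSet S₁ → rightSet S₂) : Set (K₂ →L[ℂ] H₂) :=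
  {T | ∀ Q : rightSet S₁, (Q : Proj H₂).op ∘L T ∘L (ψ Q : Proj K₂).perp = 0}

end Bilattices

end

/-! Call an operator an intertwiner if it maps the range of each projection in one lattice into the
range of the projection that a homomorphism matches with it. All inclusions that involve products of
the six spaces come from one cancellation (`Proj.corner_comp_eq_zero`), and they pass to weak*
closures because corner equations are weak* closed. The converse inclusions all follow from one
fact: the spans of `V₁W₁` and of `V₂W₂` contain nets of contractions converging strongly to the
identity (`isApproximable_univ`). If `A` and `B` run through such nets, `A T B` tends to `T`
boundedly and strongly, hence weak*, and `V₂W₂ T V₁W₁` lies in `V₂ (W₂ T V₁) W₁`, where the middle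
factor belongs to `𝔐(S¹)`.

To build such a net, let `p` and `q` be the two representations of the source lattice and fix a
vector `w`. The functions `‖q a w‖²` and `‖p a x‖²` are modular and continuous along directed sets.
Since `q a` is determined by `p a`, a minimax argument (`IsNormalModular.exists_dominating`) bounds
the increments of the first by those of finitely many functions of the second kind, up to `ε`. After
amplification a single vector `x` suffices.

On a finite part of the lattice, domination is the cut condition of a flow problem. Linear
programming duality and a layer cake integral (`chain_cover_lower_bound`) yield a flow from `w`
upwards through `x` and upwards again to `w`. Its two halves become operators `S` and `T` with `S w
= T w = h x`, where `h` is a positive contraction commuting with `p`; weak operator compactness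
extends this to the whole lattice. The operator `T* (δ + h)⁻¹ S` is then a contraction in the
product of the intertwiner spaces that nearly fixes `w`. Splitting along projections commuting with
`q` passes from one vector to finitely many. -/

section Packing

/-! ### Linear programming duality and flows through finite posets -/

/-- Linear programming duality for fractional packings. -/
theorem exists_fractional_packing {E I : Type*} [Fintype E] [Fintype I] (A : E → I → ℝ)
    (b : I → ℝ) (hb : ∀ i, 0 ≤ b i) (s : ℝ) (hs : 0 ≤ s)
    (H : ∀ y : I → ℝ, (∀ i, 0 ≤ y i) → (∀ e, 1 ≤ ∑ i, A e i * y i) → s ≤ ∑ i, b i * y i) :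
    ∃ w : E → ℝ, (∀ e, 0 ≤ w e) ∧ (∀ i, ∑ e, w e * A e i ≤ b i) ∧ ∑ e, w e = s := by
  classical
  rcases hs.eq_or_lt with rfl | hs
  · exact ⟨0, by simp, by simpa using hb, by simp⟩
  let Φ : (E → ℝ) →ₗ[ℝ] (I → ℝ) :=
    { toFun := fun w i => ∑ e, s * w e * A e i
      map_add' := fun x y => by
        ext i; simp [mul_add, add_mul, Finset.sum_add_distrib]
      map_smul' := fun c x => by
        ext i; simp only [Pi.smul_apply, smul_eq_mul, RingHom.id_apply, Finset.mul_sum]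
        exact Finset.sum_congr rfl fun e _ => by ring }
  have hΦ : Continuous Φ := Φ.continuous_of_finiteDimensional
  by_cases hdis : Disjoint (Φ '' stdSimplex ℝ E) (Set.Iic b)
  · exfalso
    obtain ⟨f, u, v, hu, huv, hv⟩ := geometric_hahn_banach_compact_closed
      ((convex_stdSimplex ℝ E).linear_image Φ) ((isCompact_stdSimplex ℝ E).image hΦ)
      (convex_Iic b) isClosed_Iic hdis
    have hf : ∀ c : I → ℝ, f c = ∑ i, c i * f (Pi.single i 1) := by
      intro c
      have : c = ∑ i, c i • (Pi.single i 1 : I → ℝ) := by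
        ext j; simp [Finset.sum_apply, Pi.single_apply]
      conv_lhs => rw [this]
      simp
    -- `Set.Iic b` is unbounded downwards: with a positive coefficient, moving down from `b` along
    -- that coordinate would bring `f` to the value `v`.
    have hneg : ∀ i, f (Pi.single i 1) ≤ 0 := by
      intro i
      by_contra! hpos
      have hbv := hv b (by simp)
      have := hv (b - ((f b - v) / f (Pi.single i 1)) • Pi.single i 1) (by
        intro j
        have : 0 ≤ ((f b - v) / f (Pi.single i 1)) * (Pi.single i (1 : ℝ) : I → ℝ) j := by
          apply mul_nonneg (div_nonneg (by linarith) hpos.le)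
          by_cases h : j = i
          · subst h; simp
          · simp [h]
        simpa using this)
      rw [map_sub, map_smul, smul_eq_mul, div_mul_cancel₀ _ hpos.ne'] at this
      linarith
    set y : I → ℝ := fun i => - f (Pi.single i 1) with hy
    have hy0 : ∀ i, 0 ≤ y i := fun i => by have := hneg i; simp only [hy]; linarith
    have hfy : ∀ c : I → ℝ, f c = - ∑ i, c i * y i := by
      intro c; rw [hf c]; simp [hy]
    have hby : 0 ≤ ∑ i, b i * y i := Finset.sum_nonneg fun i _ => mul_nonneg (hb i) (hy0 i)
    have hbv := hv b (by simp)
    rw [hfy] at hbv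
    have hu0 : 0 < -u := by linarith
    -- The separating functional, with its sign reversed and rescaled so that the level `u` becomes
    -- a covering requirement of `1`, is a fractional cover. Its cost is less than `s` because `f b
    -- > v > u`.
    have key := H (fun i => s / (-u) * y i) (fun i => mul_nonneg (by positivity) (hy0 i)) (by
      intro e
      have h1 := hu (Φ (Pi.single e 1)) ⟨_, single_mem_stdSimplex ℝ e, rfl⟩
      have h2 : Φ (Pi.single e 1) = fun i => s * A e i := by
        ext i
        simp [Φ, Pi.single_apply]
      rw [h2, hfy] at h1
      have h3 : ∑ i, A e i * (s / (-u) * y i) = (∑ i, s * A e i * y i) / (-u) := by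
        rw [Finset.sum_div]; exact Finset.sum_congr rfl fun i _ => by ring
      rw [h3, le_div_iff₀ hu0]
      linarith)
    have h3 : ∑ i, b i * (s / (-u) * y i) = s * ((∑ i, b i * y i) / (-u)) := by
      rw [Finset.sum_div, Finset.mul_sum]; exact Finset.sum_congr rfl fun i _ => by ring
    rw [h3] at key
    have h4 : (∑ i, b i * y i) / (-u) < 1 := by rw [div_lt_one hu0]; linarith
    nlinarith
  · rw [Set.not_disjoint_iff] at hdis
    obtain ⟨_, ⟨w, hw, rfl⟩, hwb⟩ := hdis
    refine ⟨fun e => s * w e, fun e => mul_nonneg hs.le (hw.1 e), fun i => hwb i, ?_⟩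
    rw [← Finset.mul_sum, hw.2, mul_one]

open MeasureTheory in
theorem integral_indicator_Ico {a b : ℝ} (ha : 0 ≤ a) (hb : b ≤ 1) :
    (∫ t in Set.Icc (0 : ℝ) 1, if a ≤ t ∧ t < b then (1 : ℝ) else 0) = max (b - a) 0 := by
  have h1 : (fun t : ℝ => if a ≤ t ∧ t < b then (1 : ℝ) else 0) =
      (Set.Ico a b).indicator (fun _ => 1) := by
    ext t; simp [Set.indicator_apply]
  rw [h1, integral_indicator measurableSet_Ico, setIntegral_const,
    measureReal_restrict_apply measurableSet_Ico]
  have : Set.Ico a b ∩ Set.Icc 0 1 = Set.Ico a b :=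
    Set.inter_eq_left.mpr fun t ht => ⟨ha.trans ht.1, ht.2.le.trans hb⟩
  rw [this]
  simp

open MeasureTheory in
/-- The dual estimate for flows through a finite poset, by the layer cake formula. -/
theorem chain_cover_lower_bound {Ω : Type*} [Fintype Ω] [PartialOrder Ω] (ν μ : Ω → ℝ)
    (hν : ∀ τ, 0 ≤ ν τ) (hμ : ∀ τ, 0 ≤ μ τ) {ε : ℝ}
    (hup : ∀ U U' : Finset Ω, IsUpperSet (U : Set Ω) → IsUpperSet (U' : Set Ω) → U ⊆ U' →
      ∑ τ ∈ U', ν τ - ∑ τ ∈ U, ν τ ≤ ∑ τ ∈ U', μ τ - ∑ τ ∈ U, μ τ + ε)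
    (f h g : Ω → ℝ) (hf : ∀ τ, 0 ≤ f τ) (hh : ∀ τ, 0 ≤ h τ) (hg : ∀ τ, 0 ≤ g τ)
    (hc : ∀ σ τ ρ, σ ≤ τ → τ ≤ ρ → 1 ≤ f σ + h τ + g ρ) :
    ∑ τ, ν τ - ε ≤ ∑ τ, ν τ * f τ + ∑ τ, μ τ * h τ + ∑ τ, ν τ * g τ := by
  classical
  -- Replacing `f` by its minimum over smaller elements and `g` by its minimum over larger ones
  -- makes them antitone and monotone, while the chain condition still gives `1 ≤ F + h + G`
  -- pointwise.
  have hF : ∀ τ, ∃ σ ≤ τ, ∀ σ' ≤ τ, f σ ≤ f σ' := fun τ => by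
    obtain ⟨σ, h1, h2⟩ := (Finset.univ.filter (· ≤ τ)).exists_min_image f ⟨τ, by simp⟩
    exact ⟨σ, by simpa using h1, fun σ' h => h2 σ' (by simpa using h)⟩
  have hG : ∀ τ, ∃ ρ, τ ≤ ρ ∧ ∀ ρ', τ ≤ ρ' → g ρ ≤ g ρ' := fun τ => by
    obtain ⟨σ, h1, h2⟩ := (Finset.univ.filter (τ ≤ ·)).exists_min_image g ⟨τ, by simp⟩
    exact ⟨σ, by simpa using h1, fun σ' h => h2 σ' (by simpa using h)⟩
  choose F' hF1 hF2 using hF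
  choose G' hG1 hG2 using hG
  set F : Ω → ℝ := fun τ => f (F' τ) with hFdef
  set G : Ω → ℝ := fun τ => g (G' τ) with hGdef
  have hFmono : ∀ σ τ, σ ≤ τ → F τ ≤ F σ := fun σ τ h => hF2 τ _ ((hF1 σ).trans h)
  have hGmono : ∀ σ τ, σ ≤ τ → G σ ≤ G τ := fun σ τ h => hG2 σ _ (h.trans (hG1 τ))
  have hcov : ∀ τ, 1 ≤ F τ + h τ + G τ := fun τ => hc _ _ _ (hF1 τ) (hG1 τ)
  -- The level set `G ≤ t < 1 - F` is the difference of the nested upper sets `{t < G}` and `{t < G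
  -- ∨ t < 1 - F}`, so the cut condition applies to it.
  have hlevel : ∀ t : ℝ, (∑ τ, ν τ * (if G τ ≤ t ∧ t < 1 - F τ then (1 : ℝ) else 0)) ≤
      (∑ τ, μ τ * (if G τ ≤ t ∧ t < 1 - F τ then (1 : ℝ) else 0)) + ε := by
    intro t
    have := hup (Finset.univ.filter fun τ => t < G τ)
      (Finset.univ.filter fun τ => t < G τ ∨ t < 1 - F τ)
      (by intro a b hab ha; simp at ha ⊢; exact ha.trans_le (hGmono a b hab))
      (by
        intro a b hab ha; simp at ha ⊢
        rcases ha with ha | ha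
        · exact Or.inl (ha.trans_le (hGmono a b hab))
        · have := hFmono a b hab; exact Or.inr (by linarith))
      (by intro a ha; simp at ha ⊢; exact Or.inl ha)
    have hdiff : ∀ κ : Ω → ℝ, (∑ τ ∈ Finset.univ.filter (fun τ => t < G τ ∨ t < 1 - F τ), κ τ) -
        (∑ τ ∈ Finset.univ.filter (fun τ => t < G τ), κ τ) =
        ∑ τ, κ τ * (if G τ ≤ t ∧ t < 1 - F τ then (1 : ℝ) else 0) := by
      intro κ
      rw [Finset.sum_filter, Finset.sum_filter, ← Finset.sum_sub_distrib]
      refine Finset.sum_congr rfl fun τ _ => ?_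
      by_cases h1 : t < G τ
      · simp [h1]
      · by_cases h2 : t < 1 - F τ
        · simp [h1, h2, not_lt.mp h1]
        · simp [h1, h2]
    rwa [hdiff, hdiff] at this
  have hint : ∀ κ : Ω → ℝ, Integrable
      (fun t => ∑ τ, κ τ * (if G τ ≤ t ∧ t < 1 - F τ then (1 : ℝ) else 0))
      (volume.restrict (Set.Icc (0 : ℝ) 1)) ∧
      ∫ t in Set.Icc (0 : ℝ) 1, ∑ τ, κ τ * (if G τ ≤ t ∧ t < 1 - F τ then (1 : ℝ) else 0) =
        ∑ τ, κ τ * max (1 - F τ - G τ) 0 := by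
    intro κ
    have hi : ∀ τ ∈ Finset.univ, Integrable
        (fun t => κ τ * (if G τ ≤ t ∧ t < 1 - F τ then (1 : ℝ) else 0))
        (volume.restrict (Set.Icc (0 : ℝ) 1)) := by
      intro τ _
      refine Integrable.const_mul ?_ _
      have h1 : (fun t : ℝ => if G τ ≤ t ∧ t < 1 - F τ then (1 : ℝ) else 0) =
          (Set.Ico (G τ) (1 - F τ)).indicator (fun _ => 1) := by
        ext t; simp [Set.indicator_apply]
      rw [h1]
      exact (integrable_const _).indicator measurableSet_Ico
    refine ⟨integrable_finsetSum _ hi, ?_⟩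
    rw [integral_finsetSum _ hi]
    refine Finset.sum_congr rfl fun τ _ => ?_
    rw [integral_const_mul, integral_indicator_Ico (hg _)]
    have := hf (F' τ); simp only [hFdef]; linarith
  -- Integrating over `t ∈ [0, 1]` turns each indicator into the length of its interval; the error
  -- `ε` is counted once because the interval has length one.
  have hmain : ∑ τ, ν τ * max (1 - F τ - G τ) 0 ≤ ∑ τ, μ τ * max (1 - F τ - G τ) 0 + ε := by
    have := integral_mono (hint ν).1 ((hint μ).1.add (integrable_const ε)) hlevel
    simp only [Pi.add_apply] at this
    rw [integral_add (hint μ).1 (integrable_const ε), (hint ν).2, (hint μ).2] at this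
    simpa using this
  have h1 : ∑ τ, μ τ * max (1 - F τ - G τ) 0 ≤ ∑ τ, μ τ * h τ :=
    Finset.sum_le_sum fun τ _ => mul_le_mul_of_nonneg_left
      (max_le (by have := hcov τ; linarith) (hh τ)) (hμ τ)
  have h2 : ∑ τ, ν τ ≤ ∑ τ, ν τ * f τ + ∑ τ, ν τ * max (1 - F τ - G τ) 0 + ∑ τ, ν τ * g τ := by
    rw [← Finset.sum_add_distrib, ← Finset.sum_add_distrib]
    refine Finset.sum_le_sum fun τ _ => ?_
    have e1 := hF2 τ τ le_rfl
    have e2 := hG2 τ τ le_rfl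
    have e3 := le_max_left (1 - F τ - G τ) 0
    have : 1 ≤ f τ + max (1 - F τ - G τ) 0 + g τ := by simp only [hFdef, hGdef] at *; linarith
    nlinarith [hν τ]
  linarith

/-- A flow through a finite poset: mass is moved upwards from `ν` through `μ` to `ν`. -/
theorem exists_chain_flow {Ω : Type*} [Fintype Ω] [PartialOrder Ω] (ν μ : Ω → ℝ)
    (hν : ∀ τ, 0 ≤ ν τ) (hμ : ∀ τ, 0 ≤ μ τ) {ε : ℝ}
    (hup : ∀ U U' : Finset Ω, IsUpperSet (U : Set Ω) → IsUpperSet (U' : Set Ω) → U ⊆ U' →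
      ∑ τ ∈ U', ν τ - ∑ τ ∈ U, ν τ ≤ ∑ τ ∈ U', μ τ - ∑ τ ∈ U, μ τ + ε) :
    ∃ α β : Ω → Ω → ℝ, (∀ σ τ, 0 ≤ α σ τ) ∧ (∀ σ τ, 0 ≤ β σ τ) ∧
      (∀ σ τ, ¬ σ ≤ τ → α σ τ = 0) ∧ (∀ σ τ, ¬ τ ≤ σ → β σ τ = 0) ∧
      (∀ σ, ∑ τ, α σ τ ≤ ν σ) ∧ (∀ σ, ∑ τ, β σ τ ≤ ν σ) ∧
      (∀ τ, ∑ σ, α σ τ ≤ μ τ) ∧ (∀ τ, ∑ σ, β σ τ = ∑ σ, α σ τ) ∧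
      ∑ τ, ν τ - ε ≤ ∑ τ, ∑ σ, α σ τ := by
  classical
  rcases lt_or_ge (∑ τ, ν τ - ε) 0 with hneg | hpos
  · exact ⟨0, 0, by simp, by simp, by simp, by simp, by simpa using hν, by simpa using hν,
      by simpa using hμ, by simp, by simpa using hneg.le⟩
  -- Packed objects are chains `σ ≤ τ ≤ ρ`, which use capacity `ν` at `σ`, `μ` at `τ` and `ν` at
  -- `ρ`. The matrices `α` and `β` will be the marginals on `(σ, τ)` and `(ρ, τ)`.
  let E := {c : Ω × Ω × Ω // c.1 ≤ c.2.1 ∧ c.2.1 ≤ c.2.2}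
  let A : E → (Ω ⊕ Ω ⊕ Ω) → ℝ := fun e =>
    Sum.elim (Pi.single e.1.1 1) (Sum.elim (Pi.single e.1.2.1 1) (Pi.single e.1.2.2 1))
  have hsum : ∀ (e : E) (y : Ω ⊕ Ω ⊕ Ω → ℝ), ∑ i, A e i * y i =
      y (.inl e.1.1) + y (.inr (.inl e.1.2.1)) + y (.inr (.inr e.1.2.2)) := by
    intro e y
    simp [A, Pi.single_apply, add_assoc]
  obtain ⟨w, hw0, hwb, hws⟩ := exists_fractional_packing A (Sum.elim ν (Sum.elim μ ν))
    (by rintro (i | i | i) <;> simp [hν, hμ]) _ hpos (by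
      intro y hy0 hy
      have := chain_cover_lower_bound ν μ hν hμ hup (fun τ => y (.inl τ))
        (fun τ => y (.inr (.inl τ))) (fun τ => y (.inr (.inr τ))) (fun _ => hy0 _)
        (fun _ => hy0 _) (fun _ => hy0 _) (by
          intro σ τ ρ h1 h2
          have := hy ⟨(σ, τ, ρ), h1, h2⟩
          rwa [hsum] at this)
      simpa [add_assoc] using this)
  let π : Ω → Ω → Ω → ℝ := fun σ τ ρ =>
    if hc : σ ≤ τ ∧ τ ≤ ρ then w ⟨(σ, τ, ρ), hc⟩ else 0
  have hπ0 : ∀ σ τ ρ, 0 ≤ π σ τ ρ := by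
    intro σ τ ρ; simp only [π]; split_ifs
    · exact hw0 _
    · exact le_rfl
  have hsumE : ∀ k : Ω → Ω → Ω → ℝ, ∑ e : E, w e * k e.1.1 e.1.2.1 e.1.2.2 =
      ∑ σ, ∑ τ, ∑ ρ, π σ τ ρ * k σ τ ρ := by
    intro k
    have h1 : ∑ σ, ∑ τ, ∑ ρ, π σ τ ρ * k σ τ ρ =
        ∑ c : Ω × Ω × Ω, π c.1 c.2.1 c.2.2 * k c.1 c.2.1 c.2.2 := by
      simp only [Fintype.sum_prod_type]
    rw [h1]
    have h2 := Finset.sum_subtype_eq_sum_filter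
      (s := (Finset.univ : Finset (Ω × Ω × Ω))) (p := fun c => c.1 ≤ c.2.1 ∧ c.2.1 ≤ c.2.2)
      (f := fun c => π c.1 c.2.1 c.2.2 * k c.1 c.2.1 c.2.2)
    rw [Finset.sum_filter] at h2
    have h3 : ∀ c : Ω × Ω × Ω, (if c.1 ≤ c.2.1 ∧ c.2.1 ≤ c.2.2 then
        π c.1 c.2.1 c.2.2 * k c.1 c.2.1 c.2.2 else 0) = π c.1 c.2.1 c.2.2 * k c.1 c.2.1 c.2.2 := by
      intro c
      by_cases hc : c.1 ≤ c.2.1 ∧ c.2.1 ≤ c.2.2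
      · rw [if_pos hc]
      · rw [if_neg hc]; simp [π, hc]
    simp only [h3] at h2
    rw [← h2, Finset.subtype_univ]
    refine Finset.sum_congr rfl fun e _ => ?_
    have : π e.1.1 e.1.2.1 e.1.2.2 = w e := by simp only [π]; rw [dif_pos e.2]
    rw [this]
  have htot : ∑ τ, ∑ σ, ∑ ρ, π σ τ ρ = ∑ τ, ν τ - ε := by
    have := hsumE (fun _ _ _ => 1)
    simp only [mul_one] at this
    rw [Finset.sum_comm, ← this, hws]
  refine ⟨fun σ τ => ∑ ρ, π σ τ ρ, fun ρ τ => ∑ σ, π σ τ ρ,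
    fun _ _ => Finset.sum_nonneg fun _ _ => hπ0 _ _ _,
    fun _ _ => Finset.sum_nonneg fun _ _ => hπ0 _ _ _,
    fun σ τ h => Finset.sum_eq_zero fun ρ _ => by simp [π, h],
    fun ρ τ h => Finset.sum_eq_zero fun σ _ => by simp [π, h], ?_, ?_, ?_, ?_, ?_⟩
  · intro i
    have h1 := hwb (.inl i)
    have h2 := hsumE (fun σ τ ρ => (Pi.single σ 1 : Ω → ℝ) i)
    simp only [A, Sum.elim_inl] at h1
    rw [h2] at h1
    simpa [Pi.single_apply, Finset.sum_ite_eq, ← Finset.sum_mul] using h1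
  · intro i
    have h1 := hwb (.inr (.inr i))
    have h2 := hsumE (fun σ τ ρ => (Pi.single ρ 1 : Ω → ℝ) i)
    simp only [A, Sum.elim_inr] at h1
    rw [h2] at h1
    rw [Finset.sum_comm]
    simpa [Pi.single_apply] using h1
  · intro i
    have h1 := hwb (.inr (.inl i))
    have h2 := hsumE (fun σ τ ρ => (Pi.single τ 1 : Ω → ℝ) i)
    simp only [A, Sum.elim_inl, Sum.elim_inr] at h1
    rw [h2] at h1
    simpa [Pi.single_apply, ← Finset.sum_mul] using h1
  · intro τ
    rw [Finset.sum_comm]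
  · exact htot.ge

end Packing

/-! ### Normal modular functions and a minimax theorem -/

section Modular

open Filter Topology

/-- Modular functions on a complete lattice which are continuous along directed sets. -/
structure IsNormalModular {Γ : Type*} [CompleteLattice Γ] (F : Γ → ℝ) : Prop where
  modular : ∀ a b, F (a ⊔ b) + F (a ⊓ b) = F a + F b
  tendsto_sSup : ∀ D : Set Γ, D.Nonempty → DirectedOn (· ≤ ·) D →
    Tendsto (fun d : D => F d) atTop (𝓝 (F (sSup D)))
  tendsto_sInf : ∀ D : Set Γ, D.Nonempty → DirectedOn (· ≥ ·) D →
    Tendsto (fun d : D => F d) atBot (𝓝 (F (sInf D)))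

theorem atTop_neBot_of_directedOn {Γ : Type*} [Preorder Γ] {D : Set Γ} (hD : D.Nonempty)
    (h : DirectedOn (· ≤ ·) D) : (atTop : Filter D).NeBot := by
  have : Nonempty D := hD.to_subtype
  have : IsDirectedOrder D := ⟨fun x y => by
    obtain ⟨z, hz, h1, h2⟩ := h x x.2 y y.2
    exact ⟨⟨z, hz⟩, h1, h2⟩⟩
  exact atTop_neBot

theorem atBot_neBot_of_directedOn {Γ : Type*} [Preorder Γ] {D : Set Γ} (hD : D.Nonempty)
    (h : DirectedOn (· ≥ ·) D) : (atBot : Filter D).NeBot := by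
  have : Nonempty D := hD.to_subtype
  have : IsCodirectedOrder D := ⟨fun x y => by
    obtain ⟨z, hz, h1, h2⟩ := h x x.2 y y.2
    exact ⟨⟨z, hz⟩, h1, h2⟩⟩
  exact atBot_neBot

namespace IsNormalModular

variable {Γ : Type*} [CompleteLattice Γ] {F G : Γ → ℝ}

theorem le_sSup (hF : IsNormalModular F) {D : Set Γ} (hD : D.Nonempty)
    (h : DirectedOn (· ≤ ·) D) {c : ℝ} (hc : ∀ d ∈ D, c ≤ F d) : c ≤ F (sSup D) :=
  haveI := atTop_neBot_of_directedOn hD h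
  ge_of_tendsto (hF.tendsto_sSup D hD h) (Eventually.of_forall fun d => hc d d.2)

theorem le_sInf (hF : IsNormalModular F) {D : Set Γ} (hD : D.Nonempty)
    (h : DirectedOn (· ≥ ·) D) {c : ℝ} (hc : ∀ d ∈ D, c ≤ F d) : c ≤ F (sInf D) :=
  haveI := atBot_neBot_of_directedOn hD h
  ge_of_tendsto (hF.tendsto_sInf D hD h) (Eventually.of_forall fun d => hc d d.2)

theorem sub (hF : IsNormalModular F) (hG : IsNormalModular G) :
    IsNormalModular (fun a => F a - G a) where
  modular a b := by linarith [hF.modular a b, hG.modular a b]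
  tendsto_sSup D hD h := (hF.tendsto_sSup D hD h).sub (hG.tendsto_sSup D hD h)
  tendsto_sInf D hD h := (hF.tendsto_sInf D hD h).sub (hG.tendsto_sInf D hD h)

theorem const_mul (hF : IsNormalModular F) (c : ℝ) : IsNormalModular (fun a => c * F a) where
  modular a b := by linear_combination c * hF.modular a b
  tendsto_sSup D hD h := (hF.tendsto_sSup D hD h).const_mul c
  tendsto_sInf D hD h := (hF.tendsto_sInf D hD h).const_mul c

theorem sum {ι : Type*} (s : Finset ι) {F : ι → Γ → ℝ} (hF : ∀ i, IsNormalModular (F i)) :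
    IsNormalModular (fun a => ∑ i ∈ s, F i a) where
  modular a b := by
    rw [← Finset.sum_add_distrib, ← Finset.sum_add_distrib]
    exact Finset.sum_congr rfl fun i _ => (hF i).modular a b
  tendsto_sSup D hD h := tendsto_finsetSum _ fun i _ => (hF i).tendsto_sSup D hD h
  tendsto_sInf D hD h := tendsto_finsetSum _ fun i _ => (hF i).tendsto_sInf D hD h

theorem comp_of_map {Λ : Type*} [CompleteLattice Λ] (hF : IsNormalModular F)
    (f : CompleteLatticeHom Λ Γ) : IsNormalModular (fun a => F (f a)) where
  modular a b := by rw [map_sup f a b, map_inf f a b, hF.modular]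
  tendsto_sSup D hD h := by
    have hdir : DirectedOn (· ≤ ·) (f '' D) := by
      rintro _ ⟨a, ha, rfl⟩ _ ⟨b, hb, rfl⟩
      obtain ⟨c, hc, h1, h2⟩ := h a ha b hb
      exact ⟨f c, ⟨c, hc, rfl⟩, OrderHomClass.mono f h1, OrderHomClass.mono f h2⟩
    have h1 := hF.tendsto_sSup _ (hD.image f) hdir
    rw [map_sSup]
    refine h1.comp (g := fun d : (f '' D) => F d)
      (f := fun d : D => (⟨f d, d, d.2, rfl⟩ : (f '' D))) ?_
    refine Monotone.tendsto_atTop_atTop (fun a b hab => ?_) ?_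
    · exact OrderHomClass.mono f hab
    · rintro ⟨_, a, ha, rfl⟩
      exact ⟨⟨a, ha⟩, le_rfl⟩
  tendsto_sInf D hD h := by
    have hdir : DirectedOn (· ≥ ·) (f '' D) := by
      rintro _ ⟨a, ha, rfl⟩ _ ⟨b, hb, rfl⟩
      obtain ⟨c, hc, h1, h2⟩ := h a ha b hb
      exact ⟨f c, ⟨c, hc, rfl⟩, OrderHomClass.mono f h1, OrderHomClass.mono f h2⟩
    have h1 := hF.tendsto_sInf _ (hD.image f) hdir
    rw [map_sInf]
    refine h1.comp (g := fun d : (f '' D) => F d)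
      (f := fun d : D => (⟨f d, d, d.2, rfl⟩ : (f '' D))) ?_
    refine Monotone.tendsto_atBot_atBot (fun a b hab => ?_) ?_
    · exact OrderHomClass.mono f hab
    · rintro ⟨_, a, ha, rfl⟩
      exact ⟨⟨a, ha⟩, le_rfl⟩

end IsNormalModular

/-- The coordinate projections of a product of complete lattices. -/
def fstCompleteLatticeHom (Λ : Type*) [CompleteLattice Λ] : CompleteLatticeHom (Λ × Λ) Λ where
  toFun := Prod.fst
  map_sInf' s := Prod.fst_sInf s
  map_sSup' s := Prod.fst_sSup s

/-- The coordinate projections of a product of complete lattices. -/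
def sndCompleteLatticeHom (Λ : Type*) [CompleteLattice Λ] : CompleteLatticeHom (Λ × Λ) Λ where
  toFun := Prod.snd
  map_sInf' s := Prod.snd_sInf s
  map_sSup' s := Prod.snd_sSup s

section Minimax

variable {Γ : Type*} [CompleteLattice Γ] {C : Set Γ}

/-- Joins of the first `n + 1` terms of a sequence from the index `k` on. -/
def iterSup (a : ℕ → Γ) : ℕ → ℕ → Γ
  | 0, k => a k
  | n + 1, k => a k ⊔ iterSup a n (k + 1)

theorem iterSup_le_succ (a : ℕ → Γ) (n k : ℕ) : iterSup a n k ≤ iterSup a (n + 1) k := by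
  induction n generalizing k with
  | zero => exact le_sup_left
  | succ n ih => exact sup_le_sup_left (ih (k + 1)) _

/-- Near-maximizers of a decreasing sequence of normal modular functions accumulate at a point
where all functions are at least as large as the limit of their suprema. -/
theorem exists_le_of_near_maximizers (hC : ∀ s ⊆ C, s.Nonempty → sSup s ∈ C ∧ sInf s ∈ C)
    (F : ℕ → Γ → ℝ) (hF : ∀ k, IsNormalModular (F k))
    (anti : ∀ k, ∀ γ ∈ C, F (k + 1) γ ≤ F k γ) (S : ℝ)
    (hle : ∀ k, ∀ γ ∈ C, F k γ ≤ S + (1 / 2) ^ k)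
    (hge : ∀ k, ∃ γ ∈ C, S - (1 / 2) ^ k ≤ F k γ) : ∃ γ ∈ C, ∀ k, S ≤ F k γ := by
  have hsup : ∀ x ∈ C, ∀ y ∈ C, x ⊔ y ∈ C ∧ x ⊓ y ∈ C := by
    intro x hx y hy
    have := hC {x, y} (by rintro z (rfl | rfl) <;> assumption) ⟨x, by simp⟩
    rwa [sSup_pair, sInf_pair] at this
  choose a haC ha using hge
  have hJC : ∀ n k, iterSup a n k ∈ C := by
    intro n
    induction n with
    | zero => exact haC
    | succ n ih => exact fun k => (hsup _ (haC k) _ (ih _)).1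
  -- By modularity a join loses at most the error `1` at `a k`, the error `1` in the upper bound at
  -- the meet, and half the constant for the tail, in units of `(1 / 2) ^ k`. The constant `4`
  -- solves `c = 2 + c / 2`.
  have hJ : ∀ n k, S - 4 * (1 / 2) ^ k ≤ F k (iterSup a n k) := by
    intro n
    induction n with
    | zero =>
      intro k
      have : (0 : ℝ) < (1 / 2) ^ k := by positivity
      have := ha k
      simp only [iterSup]; linarith
    | succ n ih =>
      intro k
      have h1 := (ih (k + 1)).trans (anti k _ (hJC n (k + 1)))
      have h2 := (hF k).modular (a k) (iterSup a n (k + 1))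
      have h3 := hle k _ (hsup _ (haC k) _ (hJC n (k + 1))).2
      have h4 := ha k
      rw [pow_succ] at h1
      simp only [iterSup]; linarith
  have hmono : ∀ k, Monotone fun n => iterSup a n k :=
    fun k => monotone_nat_of_le_succ fun n => iterSup_le_succ a n k
  -- The point sought is the upper limit of the near-maximizers: the infimum of the joins of their
  -- tails.
  let T : ℕ → Γ := fun k => sSup (Set.range fun n => iterSup a n k)
  have hTC : ∀ k, T k ∈ C := fun k =>
    (hC (Set.range fun n => iterSup a n k) (by rintro _ ⟨n, rfl⟩; exact hJC n k)
      (Set.range_nonempty _)).1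
  have hT : ∀ k, S - 4 * (1 / 2) ^ k ≤ F k (T k) := fun k =>
    (hF k).le_sSup (Set.range_nonempty _) (hmono k).directed_le.directedOn_range
      (by rintro _ ⟨n, rfl⟩; exact hJ n k)
  have hTanti : Antitone T := antitone_nat_of_succ_le fun k => by
    refine sSup_le ?_
    rintro _ ⟨n, rfl⟩
    exact le_trans (le_sup_right : _ ≤ iterSup a (n + 1) k) (le_sSup ⟨n + 1, rfl⟩)
  have hFanti : ∀ k l, k ≤ l → ∀ γ ∈ C, F l γ ≤ F k γ := fun k l hkl γ hγ =>
    (antitone_nat_of_succ_le (f := fun k => F k γ) fun k => anti k γ hγ) hkl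
  refine ⟨sInf (Set.range T), (hC (Set.range T) (by rintro _ ⟨k, rfl⟩; exact hTC k)
    (Set.range_nonempty T)).2, ?_⟩
  intro k
  have hlim : Tendsto (fun l : ℕ => S - 4 * (1 / 2 : ℝ) ^ l) atTop (𝓝 (S - 4 * 0)) :=
    tendsto_const_nhds.sub
      ((tendsto_pow_atTop_nhds_zero_of_lt_one (by norm_num) (by norm_num)).const_mul 4)
  rw [mul_zero, sub_zero] at hlim
  refine le_of_tendsto hlim ?_
  filter_upwards [eventually_ge_atTop k] with l hl
  have hInf : sInf (Set.range T) = sInf (T '' Set.Ici l) := by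
    apply le_antisymm
    · exact sInf_le_sInf (Set.image_subset_range _ _)
    · refine le_sInf ?_
      rintro _ ⟨m, rfl⟩
      exact le_trans (sInf_le ⟨max l m, Set.mem_Ici.mpr (le_max_left _ _), rfl⟩) (hTanti (le_max_right _ _))
  rw [hInf]
  refine (hF k).le_sInf (Set.nonempty_Ici.image T) ?_ ?_
  · rintro _ ⟨m, hm, rfl⟩ _ ⟨m', hm', rfl⟩
    exact ⟨_, ⟨max m m', Set.mem_Ici.mpr (le_trans hm (le_max_left _ _)), rfl⟩, hTanti (le_max_left _ _),
      hTanti (le_max_right _ _)⟩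
  · rintro _ ⟨m, hm, rfl⟩
    refine le_trans ?_ ((hT m).trans (hFanti k m (hl.trans hm) _ (hTC m)))
    have : (1 / 2 : ℝ) ^ m ≤ (1 / 2) ^ l :=
      pow_le_pow_of_le_one (by norm_num) (by norm_num) hm
    linarith

/-- A minimax theorem for decreasing families of normal modular functions. -/
theorem exists_forall_le_of_forall_exists_le {ι : Type*} [SemilatticeSup ι] [Nonempty ι]
    (hC : ∀ s ⊆ C, s.Nonempty → sSup s ∈ C ∧ sInf s ∈ C)
    (F : ι → Γ → ℝ) (hF : ∀ i, IsNormalModular (F i))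
    (anti : ∀ i j, i ≤ j → ∀ γ ∈ C, F j γ ≤ F i γ)
    (bdd : ∀ i, BddAbove (F i '' C)) {ε : ℝ} (h : ∀ i, ∃ γ ∈ C, ε ≤ F i γ) :
    ∃ γ ∈ C, ∀ i, ε ≤ F i γ := by
  have hsup : ∀ x ∈ C, ∀ y ∈ C, x ⊔ y ∈ C ∧ x ⊓ y ∈ C := by
    intro x hx y hy
    have := hC {x, y} (by rintro z (rfl | rfl) <;> assumption) ⟨x, by simp⟩
    rwa [sSup_pair, sInf_pair] at this
  have hCne : C.Nonempty := by
    obtain ⟨γ, hγ, -⟩ := h (Classical.arbitrary ι)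
    exact ⟨γ, hγ⟩
  let s : ι → ℝ := fun i => sSup (F i '' C)
  have hs : ∀ i, ∀ γ ∈ C, F i γ ≤ s i := fun i γ hγ => le_csSup (bdd i) ⟨γ, hγ, rfl⟩
  have hεs : ∀ i, ε ≤ s i := fun i => by
    obtain ⟨γ, hγ, hle⟩ := h i
    exact hle.trans (hs i γ hγ)
  have hbelow : BddBelow (Set.range s) := ⟨ε, by rintro _ ⟨i, rfl⟩; exact hεs i⟩
  set S : ℝ := ⨅ i, s i with hS
  have hεS : ε ≤ S := le_ciInf hεs
  have hSs : ∀ i, S ≤ s i := fun i => ciInf_le hbelow i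
  have hu : ∀ k : ℕ, ∃ i, s i < S + (1 / 2) ^ k := fun k =>
    exists_lt_of_ciInf_lt (lt_add_of_pos_right _ (by positivity))
  choose u hu using hu
  -- An increasing sequence along which the suprema approach their infimum `S`. It need not be
  -- cofinal in `ι`, which is why every index `i` is joined with it below.
  let v : ℕ → ι := partialSups u
  have hvmono : Monotone v := (partialSups u).monotone
  have hle : ∀ i k, ∀ γ ∈ C, F (i ⊔ v k) γ ≤ S + (1 / 2) ^ k := fun i k γ hγ =>
    (anti _ _ ((le_partialSups u k).trans le_sup_right) γ hγ).trans ((hs _ γ hγ).trans (hu k).le)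
  -- Along `i ⊔ v k` the suprema tend to `S`, so the elements of `Q i` are asymptotic maximizers. By
  -- modularity they are closed under joins, so `Q i` has a largest element; these elements decrease
  -- in `i`, and their infimum serves every index.
  let Q : ι → Set Γ := fun i => {γ | γ ∈ C ∧ ∀ k, S ≤ F (i ⊔ v k) γ}
  have hQne : ∀ i, (Q i).Nonempty := by
    intro i
    obtain ⟨γ, hγ, h1⟩ := exists_le_of_near_maximizers hC (fun k => F (i ⊔ v k)) (fun k => hF _)
      (fun k γ hγ => anti _ _ (sup_le_sup_left (hvmono k.le_succ) _) γ hγ) S (hle i) (by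
        intro k
        obtain ⟨_, ⟨γ, hγ, rfl⟩, h1⟩ := exists_lt_of_lt_csSup (hCne.image (F (i ⊔ v k)))
          (show S - (1 / 2) ^ k < sSup (F (i ⊔ v k) '' C) by
            have := hSs (i ⊔ v k)
            have h2 : (0 : ℝ) < (1 / 2) ^ k := by positivity
            simp only [s] at this; linarith)
        exact ⟨γ, hγ, h1.le⟩)
    exact ⟨γ, hγ, h1⟩
  have hQanti : ∀ i j, i ≤ j → Q j ⊆ Q i := fun i j hij γ hγ =>
    ⟨hγ.1, fun k => (hγ.2 k).trans (anti _ _ (sup_le_sup_right hij _) γ hγ.1)⟩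
  have hQsup : ∀ i, ∀ x ∈ Q i, ∀ y ∈ Q i, x ⊔ y ∈ Q i := by
    intro i x hx y hy
    have hxy := hsup x hx.1 y hy.1
    refine ⟨hxy.1, fun k => ?_⟩
    have hlim : Tendsto (fun l : ℕ => S - (1 / 2 : ℝ) ^ l) atTop (𝓝 (S - 0)) :=
      tendsto_const_nhds.sub
        (tendsto_pow_atTop_nhds_zero_of_lt_one (by norm_num) (by norm_num))
    rw [sub_zero] at hlim
    refine le_of_tendsto hlim ?_
    filter_upwards [eventually_ge_atTop k] with l hl
    refine le_trans ?_ (anti _ _ (sup_le_sup_left (hvmono hl) i) _ hxy.1)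
    have h1 := (hF (i ⊔ v l)).modular x y
    have h2 := hle i l _ hxy.2
    have h3 := hx.2 l
    have h4 := hy.2 l
    linarith
  let R : ι → Γ := fun i => sSup (Q i)
  have hRQ : ∀ i, R i ∈ Q i := fun i =>
    ⟨(hC _ (fun γ hγ => hγ.1) (hQne i)).1, fun k => (hF _).le_sSup (hQne i)
      (fun x hx y hy => ⟨x ⊔ y, hQsup i x hx y hy, le_sup_left, le_sup_right⟩)
      fun γ hγ => hγ.2 k⟩
  have hRanti : ∀ i j, i ≤ j → R j ≤ R i := fun i j hij => sSup_le_sSup (hQanti i j hij)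
  refine ⟨sInf (Set.range R), (hC (Set.range R) (by rintro _ ⟨k, rfl⟩; exact (hRQ k).1)
    (Set.range_nonempty R)).2, fun i => hεS.trans ?_⟩
  have hInf : sInf (Set.range R) = sInf (R '' Set.Ici (i ⊔ v 0)) := by
    apply le_antisymm
    · exact sInf_le_sInf (Set.image_subset_range _ _)
    · refine le_sInf ?_
      rintro _ ⟨m, rfl⟩
      exact le_trans (sInf_le ⟨(i ⊔ v 0) ⊔ m, le_sup_left, rfl⟩) (hRanti _ _ le_sup_right)
  rw [hInf]
  refine (hF i).le_sInf (Set.nonempty_Ici.image R) ?_ ?_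
  · rintro _ ⟨m, hm, rfl⟩ _ ⟨m', hm', rfl⟩
    exact ⟨_, ⟨m ⊔ m', le_trans hm le_sup_left, rfl⟩, hRanti _ _ le_sup_left,
      hRanti _ _ le_sup_right⟩
  · rintro _ ⟨m, hm, rfl⟩
    exact ((hRQ m).2 0).trans (anti _ _ ((le_sup_left.trans hm).trans le_sup_left) _ (hRQ m).1)

end Minimax

/-- A normal modular function which does not separate points that a family of normal valuations
identifies is dominated by the family, up to `ε`. -/
theorem IsNormalModular.exists_dominating {Λ X : Type*} [CompleteLattice Λ] {ν : Λ → ℝ}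
    (hν : IsNormalModular ν) (hν0 : ∀ a, 0 ≤ ν a) (hνmono : Monotone ν) (μ : X → Λ → ℝ)
    (hμ : ∀ x, IsNormalModular (μ x)) (hμmono : ∀ x, Monotone (μ x))
    (hsep : ∀ a b, a ≤ b → (∀ x, μ x a = μ x b) → ν a = ν b) {ε : ℝ} (hε : 0 < ε) :
    ∃ (n : ℕ) (s : Finset X), ∀ a b, a ≤ b →
      ν b - ν a ≤ n * ∑ x ∈ s, (μ x b - μ x a) + ε := by
  classical
  by_contra! hcon
  -- This family decreases in the multiplicity and in the finite set. If domination failed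
  -- throughout, minimax would give one pair `a ≤ b` violating it for all of them; letting `n` grow
  -- forces `μ x a = μ x b` for every `x`, while the index `(0, ∅)` forces `ν a ≠ ν b`.
  let F : ℕ × Finset X → Λ × Λ → ℝ := fun i γ =>
    (ν γ.2 - ν γ.1) - i.1 * ∑ x ∈ i.2, (μ x γ.2 - μ x γ.1)
  have hpair : ∀ {f : Λ → ℝ}, IsNormalModular f →
      IsNormalModular fun γ : Λ × Λ => f γ.2 - f γ.1 := fun hf =>
    (hf.comp_of_map (sndCompleteLatticeHom Λ)).sub (hf.comp_of_map (fstCompleteLatticeHom Λ))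
  have hsum0 : ∀ (s : Finset X) (γ : Λ × Λ), γ.1 ≤ γ.2 → 0 ≤ ∑ x ∈ s, (μ x γ.2 - μ x γ.1) :=
    fun s γ hγ => Finset.sum_nonneg fun x _ => sub_nonneg.mpr (hμmono x hγ)
  suffices ∃ γ ∈ {γ : Λ × Λ | γ.1 ≤ γ.2}, ∀ i, ε ≤ F i γ by
    obtain ⟨⟨a, b⟩, hab, hF⟩ := this
    have hzero : ∀ x, μ x a = μ x b := by
      intro x
      refine le_antisymm (hμmono x hab) ?_
      by_contra! hlt
      obtain ⟨n, hn⟩ := exists_nat_gt ((ν b - ν a) / (μ x b - μ x a))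
      rw [div_lt_iff₀ (by linarith)] at hn
      have := hF (n, {x})
      simp only [F, Finset.sum_singleton] at this
      linarith
    have h1 := hF (0, ∅)
    have h2 := hsep a b hab hzero
    simp only [F, h2] at h1
    simp at h1
    linarith
  refine exists_forall_le_of_forall_exists_le ?_ F ?_ ?_ ?_ ?_
  · intro s hs hne
    constructor
    · refine (sSup_le_iff.mpr ?_ : (sSup s).1 ≤ (sSup s).2)
      rintro _ ⟨γ, hγ, rfl⟩
      exact (hs hγ).trans (_root_.le_sSup hγ).2
    · refine (_root_.le_sInf_iff.mpr ?_ : (sInf s).1 ≤ (sInf s).2)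
      rintro _ ⟨γ, hγ, rfl⟩
      exact le_trans (_root_.sInf_le hγ).1 (hs hγ)
  · exact fun i => (hpair hν).sub ((IsNormalModular.sum i.2 fun x => hpair (hμ x)).const_mul _)
  · rintro ⟨n, s⟩ ⟨m, t⟩ ⟨hnm, hst⟩ γ hγ
    have h1 : ∑ x ∈ s, (μ x γ.2 - μ x γ.1) ≤ ∑ x ∈ t, (μ x γ.2 - μ x γ.1) :=
      Finset.sum_le_sum_of_subset_of_nonneg hst fun x _ _ => sub_nonneg.mpr (hμmono x hγ)
    have h2 : (n : ℝ) ≤ m := by exact_mod_cast hnm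
    have h3 := mul_le_mul h2 h1 (hsum0 s γ hγ) (Nat.cast_nonneg m)
    simp only [F]; linarith
  · rintro ⟨n, s⟩
    refine ⟨ν ⊤, ?_⟩
    rintro _ ⟨γ, hγ, rfl⟩
    have h1 := mul_nonneg (Nat.cast_nonneg (α := ℝ) n) (hsum0 s γ hγ)
    have h2 := hνmono (le_top : γ.2 ≤ ⊤)
    have h3 := hν0 γ.1
    simp only [F]; linarith
  · rintro ⟨n, s⟩
    obtain ⟨a, b, hab, h⟩ := hcon n s
    exact ⟨(a, b), hab, by simp only [F]; linarith⟩

end Modular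

/-! ### Commuting projections and the cells of a finite sublattice -/

section StarProjection

variable {H : Type*} [NormedAddCommGroup H] [InnerProductSpace ℂ H] [CompleteSpace H]

theorem IsStarProjection.inner_left {e : H →L[ℂ] H} (he : IsStarProjection e) (x y : H) :
    inner ℂ (e x) y = inner ℂ x (e y) :=
  (ContinuousLinearMap.isSelfAdjoint_iff_isSymmetric.mp he.isSelfAdjoint) x y

theorem IsStarProjection.apply_apply {e : H →L[ℂ] H} (he : IsStarProjection e) (x : H) :
    e (e x) = e x :=
  DFunLike.congr_fun he.isIdempotentElem.eq x

theorem IsStarProjection.inner_self {e : H →L[ℂ] H} (he : IsStarProjection e) (x : H) :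
    inner ℂ (e x) x = ((‖e x‖ ^ 2 : ℝ) : ℂ) := by
  rw [← he.apply_apply x, he.inner_left, inner_self_eq_norm_sq_to_K, he.apply_apply]
  simp

theorem IsStarProjection.norm_sq_add {e : H →L[ℂ] H} (he : IsStarProjection e) (x : H) :
    ‖x‖ ^ 2 = ‖e x‖ ^ 2 + ‖(1 - e) x‖ ^ 2 := by
  have h1 := he.inner_self x
  have h2 := he.one_sub.inner_self x
  have h3 : inner ℂ x x = ((‖x‖ ^ 2 : ℝ) : ℂ) := by
    rw [inner_self_eq_norm_sq_to_K]; simp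
  have h4 : inner ℂ x x = inner ℂ (e x) x + inner ℂ ((1 - e) x) x := by
    rw [← inner_add_left]; simp
  rw [h1, h2, h3] at h4
  exact_mod_cast h4

theorem IsStarProjection.norm_apply_le {e : H →L[ℂ] H} (he : IsStarProjection e) (x : H) :
    ‖e x‖ ≤ ‖x‖ := by
  have := he.norm_sq_add x
  exact le_of_sq_le_sq (by nlinarith [sq_nonneg ‖(1 - e) x‖]) (norm_nonneg _)

end StarProjection

/-- Representations of a bounded lattice by commuting projections. -/
structure IsLatticeRep {Λ H : Type*} [Lattice Λ] [BoundedOrder Λ] [NormedAddCommGroup H]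
    [InnerProductSpace ℂ H] [CompleteSpace H] (p : Λ → H →L[ℂ] H) : Prop where
  proj : ∀ a, IsStarProjection (p a)
  map_inf : ∀ a b, p (a ⊓ b) = p a * p b
  map_sup : ∀ a b, p (a ⊔ b) = p a + p b - p a * p b
  map_top : p ⊤ = 1
  map_bot : p ⊥ = 0

/-- The atoms of the Boolean algebra of projections generated by a finite set `s`. -/
def latticeCell {Λ H : Type*} [Lattice Λ] [BoundedOrder Λ] [NormedAddCommGroup H]
    [InnerProductSpace ℂ H] [DecidableEq Λ] (p : Λ → H →L[ℂ] H) (s σ : Finset Λ) : H →L[ℂ] H :=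
  p (σ.inf id) * (1 - p ((s \ σ).sup id))

namespace IsLatticeRep

variable {Λ H : Type*} [Lattice Λ] [BoundedOrder Λ] [NormedAddCommGroup H]
  [InnerProductSpace ℂ H] [CompleteSpace H] {p : Λ → H →L[ℂ] H}

theorem commute (hp : IsLatticeRep p) (a b : Λ) : Commute (p a) (p b) := by
  have h1 := hp.map_inf a b
  rw [inf_comm, hp.map_inf] at h1
  exact h1.symm

theorem mul_of_le (hp : IsLatticeRep p) {a b : Λ} (h : a ≤ b) : p a * p b = p a := by
  rw [← hp.map_inf, inf_eq_left.mpr h]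

theorem norm_apply_mono (hp : IsLatticeRep p) {a b : Λ} (h : a ≤ b) (x : H) :
    ‖p a x‖ ≤ ‖p b x‖ := by
  rw [← hp.mul_of_le h]
  exact (hp.proj a).norm_apply_le _

theorem dual (hp : IsLatticeRep p) : IsLatticeRep (Λ := Λᵒᵈ) fun a => 1 - p (OrderDual.ofDual a) where
  proj a := (hp.proj _).one_sub
  map_inf a b := by
    rw [ofDual_inf, hp.map_sup]
    noncomm_ring
  map_sup a b := by
    rw [ofDual_sup, hp.map_inf]
    noncomm_ring
  map_top := by rw [OrderDual.ofDual_top, hp.map_bot, sub_zero]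
  map_bot := by rw [OrderDual.ofDual_bot, hp.map_top, sub_self]

variable [DecidableEq Λ]

theorem isStarProjection_cell (hp : IsLatticeRep p) (s σ : Finset Λ) :
    IsStarProjection (latticeCell p s σ) :=
  (hp.proj _).mul (hp.proj _).one_sub ((Commute.one_right _).sub_right (hp.commute _ _))

theorem commute_cell (hp : IsLatticeRep p) (a : Λ) (s σ : Finset Λ) :
    Commute (p a) (latticeCell p s σ) :=
  (hp.commute _ _).mul_right ((Commute.one_right _).sub_right (hp.commute _ _))

theorem mul_cell_of_mem (hp : IsLatticeRep p) {a : Λ} {s σ : Finset Λ} (h : a ∈ σ) :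
    p a * latticeCell p s σ = latticeCell p s σ := by
  have : σ.inf id ≤ a := Finset.inf_le (f := id) h
  rw [latticeCell, ← mul_assoc, ← hp.map_inf, inf_eq_right.mpr this]

theorem mul_cell_of_notMem (hp : IsLatticeRep p) {a : Λ} {s σ : Finset Λ} (hs : a ∈ s)
    (h : a ∉ σ) : p a * latticeCell p s σ = 0 := by
  have : a ≤ (s \ σ).sup id := Finset.le_sup (f := id) (by simp [hs, h])
  rw [latticeCell, ← mul_assoc, (hp.commute a _).eq, mul_assoc, mul_sub, mul_one,
    hp.mul_of_le this, sub_self, mul_zero]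

theorem cell_mul_cell (hp : IsLatticeRep p) {s σ τ : Finset Λ} (hσ : σ ⊆ s) (hτ : τ ⊆ s)
    (h : σ ≠ τ) : latticeCell p s σ * latticeCell p s τ = 0 := by
  have key : ∀ {σ τ : Finset Λ}, σ ⊆ s → ∀ a ∈ σ, a ∉ τ →
      latticeCell p s σ * latticeCell p s τ = 0 := by
    intro σ τ hσ a h1 h2
    rw [← hp.mul_cell_of_mem h1, (hp.commute_cell a s σ).eq, mul_assoc,
      hp.mul_cell_of_notMem (hσ h1) h2, mul_zero]
  -- An element of `σ` outside `τ` gives orthogonality directly; in the opposite case the product is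
  -- obtained by taking adjoints.
  by_cases hsub : σ ⊆ τ
  · have : ¬ τ ⊆ σ := fun h' => h (Finset.Subset.antisymm hsub h')
    obtain ⟨a, h1, h2⟩ := Finset.not_subset.mp this
    have h3 := key hτ a h1 h2
    have h4 := congrArg star h3
    rwa [star_mul, (hp.isStarProjection_cell s σ).isSelfAdjoint.star_eq,
      (hp.isStarProjection_cell s τ).isSelfAdjoint.star_eq, star_zero] at h4
  · obtain ⟨a, h1, h2⟩ := Finset.not_subset.mp hsub
    exact key hσ a h1 h2

theorem sum_cell (hp : IsLatticeRep p) (s : Finset Λ) :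
    ∑ σ ∈ s.powerset, latticeCell p s σ = 1 := by
  induction s using Finset.induction_on with
  | empty => simp [latticeCell, hp.map_top, hp.map_bot]
  | insert a s ha ih =>
    rw [Finset.sum_powerset_insert ha, ← Finset.sum_add_distrib, ← ih]
    refine Finset.sum_congr rfl fun σ hσ => ?_
    have haσ : a ∉ σ := fun h => ha (Finset.mem_powerset.mp hσ h)
    have h1 : insert a s \ σ = insert a (s \ σ) := Finset.insert_sdiff_of_notMem _ haσ
    have h2 : insert a s \ insert a σ = s \ σ := by
      ext b; simp only [Finset.mem_sdiff, Finset.mem_insert]; grind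
    simp only [latticeCell]
    rw [h1, h2, Finset.sup_insert, Finset.inf_insert, id, hp.map_sup, hp.map_inf,
      (hp.commute a (σ.inf id)).eq]
    noncomm_ring

/-- The projection of a join of meets is a sum of cells. -/
theorem map_sup_inf_eq_sum_cell (hp : IsLatticeRep p) (s : Finset Λ)
    (U : Finset {σ // σ ∈ s.powerset}) (hU : IsUpperSet (U : Set {σ // σ ∈ s.powerset})) :
    p (U.sup fun σ => σ.1.inf id) = ∑ σ ∈ U, latticeCell p s σ.1 := by
  have h1 : ∀ τ : {σ // σ ∈ s.powerset}, p (U.sup fun σ => σ.1.inf id) * latticeCell p s τ.1 =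
      if τ ∈ U then latticeCell p s τ.1 else 0 := by
    intro τ
    split_ifs with hτ
    · have : τ.1.inf id ≤ U.sup fun σ => σ.1.inf id :=
        Finset.le_sup (f := fun σ : {σ // σ ∈ s.powerset} => σ.1.inf id) hτ
      rw [latticeCell, ← mul_assoc, ← hp.map_inf, inf_eq_right.mpr this]
    · have hsup : ∀ V ⊆ U, p (V.sup fun σ => σ.1.inf id) * latticeCell p s τ.1 = 0 := by
        intro V
        induction V using Finset.induction_on with
        | empty => intro _; rw [Finset.sup_empty, hp.map_bot, zero_mul]
        | insert ρ V _ ih =>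
          intro hV
          have h2 := ih fun x hx => hV (Finset.mem_insert_of_mem hx)
          have hρ : ρ ∈ U := hV (Finset.mem_insert_self _ _)
          have hρτ : ¬ ρ.1 ⊆ τ.1 := fun h => hτ (hU (show ρ ≤ τ from h) hρ)
          obtain ⟨a, ha1, ha2⟩ := Finset.not_subset.mp hρτ
          have h3 : p (ρ.1.inf id) * latticeCell p s τ.1 = 0 := by
            rw [← hp.mul_of_le (Finset.inf_le (f := id) ha1), mul_assoc, id,
              hp.mul_cell_of_notMem (Finset.mem_powerset.mp ρ.2 ha1) ha2, mul_zero]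
          rw [Finset.sup_insert, hp.map_sup, sub_mul, add_mul, mul_assoc, h2, h3]
          simp
      exact hsup U subset_rfl
  have h2 : ∑ σ : {σ // σ ∈ s.powerset}, latticeCell p s σ.1 = 1 := by
    rw [← hp.sum_cell s, ← Finset.sum_attach s.powerset]; rfl
  calc p (U.sup fun σ => σ.1.inf id)
      = ∑ τ : {σ // σ ∈ s.powerset}, p (U.sup fun σ => σ.1.inf id) * latticeCell p s τ.1 := by
        rw [← Finset.mul_sum, h2, mul_one]
    _ = _ := by simp only [h1]; rw [← Finset.sum_filter, Finset.filter_univ_mem]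

end IsLatticeRep

/-! ### Operators built from mass matrices -/

section Coupling

variable {H K Ω : Type*} [Fintype Ω] [NormedAddCommGroup H] [InnerProductSpace ℂ H]
  [CompleteSpace H] [NormedAddCommGroup K] [InnerProductSpace ℂ K] [CompleteSpace K]

/-- A finite family of projections which are mutually orthogonal and sum up to the identity. -/
structure IsPartitionOfUnity (c : Ω → H →L[ℂ] H) : Prop where
  proj : ∀ τ, IsStarProjection (c τ)
  mul_eq_zero : ∀ σ τ, σ ≠ τ → c σ * c τ = 0
  sum_eq_one : ∑ τ, c τ = 1

theorem IsPartitionOfUnity.norm_sq_sum {c : Ω → H →L[ℂ] H} (hc : ∀ τ, IsStarProjection (c τ))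
    {e : H →L[ℂ] H} (he : IsStarProjection e) {U : Finset Ω} (h : e = ∑ τ ∈ U, c τ) (x : H) :
    ∑ τ ∈ U, ‖c τ x‖ ^ 2 = ‖e x‖ ^ 2 := by
  have h1 := he.inner_self x
  rw [h, sum_apply, sum_inner,
    Finset.sum_congr rfl fun τ _ => (hc τ).inner_self x] at h1
  rw [h, sum_apply]
  exact_mod_cast h1

theorem IsPartitionOfUnity.sum_norm_sq {c : Ω → H →L[ℂ] H} (hc : IsPartitionOfUnity c) (x : H) :
    ∑ τ, ‖c τ x‖ ^ 2 = ‖x‖ ^ 2 :=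
  IsPartitionOfUnity.norm_sq_sum hc.proj (e := 1) (.one _) hc.sum_eq_one.symm x

/-- The operator with a given matrix of masses with respect to two partitions. -/
noncomputable def couplingOp (c : Ω → H →L[ℂ] H) (d : Ω → K →L[ℂ] K) (x : H) (w : K)
    (α : Ω → Ω → ℝ) : K →L[ℂ] H :=
  ∑ σ, ∑ τ, ((α σ τ / (‖d σ w‖ ^ 2 * ‖c τ x‖ ^ 2) : ℝ) : ℂ) •
    InnerProductSpace.rankOne ℂ (c τ x) (d σ w)

/-- The density of a measure on the index set of a partition. -/
noncomputable def densityOp (c : Ω → H →L[ℂ] H) (x : H) (m : Ω → ℝ) : H →L[ℂ] H :=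
  ∑ τ, ((m τ / ‖c τ x‖ ^ 2 : ℝ) : ℂ) • c τ

variable {c : Ω → H →L[ℂ] H} {d : Ω → K →L[ℂ] K} {x : H} {w : K} {α : Ω → Ω → ℝ} {m : Ω → ℝ}

theorem couplingOp_apply (y : K) : couplingOp c d x w α y =
    ∑ σ, ∑ τ, ((α σ τ / (‖d σ w‖ ^ 2 * ‖c τ x‖ ^ 2) : ℝ) : ℂ) • inner ℂ (d σ w) y • c τ x := by
  simp [couplingOp]

theorem densityOp_apply (z : H) : densityOp c x m z =
    ∑ τ, ((m τ / ‖c τ x‖ ^ 2 : ℝ) : ℂ) • c τ z := by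
  simp [densityOp]

theorem couplingOp_apply_self (hd : IsPartitionOfUnity d) (hα : ∀ σ τ, 0 ≤ α σ τ)
    (hrow : ∀ σ, ∑ τ, α σ τ ≤ ‖d σ w‖ ^ 2) (hm : ∀ τ, ∑ σ, α σ τ = m τ) :
    couplingOp c d x w α w = densityOp c x m x := by
  -- Cells where `w` vanishes carry no mass, so the division by zero in the definition is harmless.
  have h0 : ∀ σ τ, ‖d σ w‖ ^ 2 = 0 → α σ τ = 0 := fun σ τ h =>
    le_antisymm ((Finset.single_le_sum (fun τ _ => hα σ τ) (Finset.mem_univ τ)).trans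
      ((hrow σ).trans h.le)) (hα σ τ)
  rw [couplingOp_apply, densityOp_apply, Finset.sum_comm]
  refine Finset.sum_congr rfl fun τ _ => ?_
  rw [← hm τ, Finset.sum_div, Complex.ofReal_sum, Finset.sum_smul]
  refine Finset.sum_congr rfl fun σ _ => ?_
  rw [(hd.proj σ).inner_self, smul_smul, ← Complex.ofReal_mul]
  congr 2
  by_cases h : ‖d σ w‖ ^ 2 = 0
  · rw [h0 σ τ h]; simp
  · rw [div_mul_eq_mul_div, mul_comm (‖d σ w‖ ^ 2), mul_div_mul_right _ _ h]

theorem re_inner_densityOp (hc : IsPartitionOfUnity c) (z : H) :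
    inner ℂ (densityOp c x m z) z = ((∑ τ, m τ / ‖c τ x‖ ^ 2 * ‖c τ z‖ ^ 2 : ℝ) : ℂ) := by
  rw [densityOp_apply, sum_inner, Complex.ofReal_sum]
  refine Finset.sum_congr rfl fun τ _ => ?_
  rw [inner_smul_left, (hc.proj τ).inner_self, Complex.conj_ofReal, ← Complex.ofReal_mul]

/-- Cauchy–Schwarz with weight `α`: the row bound controls the factor depending on `y` by `‖y‖²`,
and the column sums `m` turn the factor depending on `z` into the quadratic form of `densityOp`.
Formally, the coupling is the square root of the density times a contraction. -/
theorem norm_inner_couplingOp_sq_le (hc : IsPartitionOfUnity c) (hd : IsPartitionOfUnity d)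
    (hα : ∀ σ τ, 0 ≤ α σ τ) (hrow : ∀ σ, ∑ τ, α σ τ ≤ ‖d σ w‖ ^ 2)
    (hm : ∀ τ, ∑ σ, α σ τ = m τ) (y : K) (z : H) :
    ‖inner ℂ z (couplingOp c d x w α y)‖ ^ 2 ≤
      ‖y‖ ^ 2 * ∑ τ, m τ / ‖c τ x‖ ^ 2 * ‖c τ z‖ ^ 2 := by
  have hb : ‖inner ℂ z (couplingOp c d x w α y)‖ ≤
      ∑ i : Ω × Ω, (√(α i.1 i.2) * (‖inner ℂ (d i.1 w) y‖ / ‖d i.1 w‖ ^ 2)) *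
        (√(α i.1 i.2) * (‖inner ℂ z (c i.2 x)‖ / ‖c i.2 x‖ ^ 2)) := by
    rw [couplingOp_apply, Fintype.sum_prod_type, inner_sum]
    refine (norm_sum_le _ _).trans (Finset.sum_le_sum fun σ _ => ?_)
    rw [inner_sum]
    refine (norm_sum_le _ _).trans (Finset.sum_le_sum fun τ _ => ?_)
    rw [inner_smul_right, inner_smul_right, norm_mul, norm_mul, Complex.norm_real,
      Real.norm_of_nonneg (div_nonneg (hα σ τ) (by positivity))]
    apply le_of_eq
    calc α σ τ / (‖d σ w‖ ^ 2 * ‖c τ x‖ ^ 2) * (‖inner ℂ (d σ w) y‖ * ‖inner ℂ z (c τ x)‖)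
        = (√(α σ τ) * √(α σ τ)) * (‖inner ℂ (d σ w) y‖ / ‖d σ w‖ ^ 2) *
          (‖inner ℂ z (c τ x)‖ / ‖c τ x‖ ^ 2) := by
          rw [Real.mul_self_sqrt (hα σ τ)]; ring
      _ = _ := by ring
  have hcs := Finset.sum_mul_sq_le_sq_mul_sq (Finset.univ : Finset (Ω × Ω))
    (fun i => √(α i.1 i.2) * (‖inner ℂ (d i.1 w) y‖ / ‖d i.1 w‖ ^ 2))
    (fun i => √(α i.1 i.2) * (‖inner ℂ z (c i.2 x)‖ / ‖c i.2 x‖ ^ 2))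
  have hfirst : ∑ i : Ω × Ω, (√(α i.1 i.2) * (‖inner ℂ (d i.1 w) y‖ / ‖d i.1 w‖ ^ 2)) ^ 2 ≤
      ‖y‖ ^ 2 := by
    rw [Fintype.sum_prod_type, ← hd.sum_norm_sq y]
    refine Finset.sum_le_sum fun σ _ => ?_
    have h1 : ∀ τ, (√(α σ τ) * (‖inner ℂ (d σ w) y‖ / ‖d σ w‖ ^ 2)) ^ 2 =
        α σ τ * (‖inner ℂ (d σ w) y‖ / ‖d σ w‖ ^ 2) ^ 2 := fun τ => by
      rw [mul_pow, Real.sq_sqrt (hα σ τ)]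
    simp only [h1]
    rw [← Finset.sum_mul]
    have h2 : ‖inner ℂ (d σ w) y‖ ≤ ‖d σ w‖ * ‖d σ y‖ := by
      rw [← (hd.proj σ).apply_apply w, (hd.proj σ).inner_left, (hd.proj σ).apply_apply]
      exact norm_inner_le_norm _ _
    by_cases h3 : ‖d σ w‖ = 0
    · rw [h3]; simp
    · have h4 : 0 < ‖d σ w‖ := lt_of_le_of_ne (norm_nonneg _) (Ne.symm h3)
      calc (∑ τ, α σ τ) * (‖inner ℂ (d σ w) y‖ / ‖d σ w‖ ^ 2) ^ 2
          ≤ ‖d σ w‖ ^ 2 * (‖d σ w‖ * ‖d σ y‖ / ‖d σ w‖ ^ 2) ^ 2 := by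
            gcongr
            exact hrow σ
        _ = ‖d σ y‖ ^ 2 := by field_simp
  have hsecond : ∑ i : Ω × Ω, (√(α i.1 i.2) * (‖inner ℂ z (c i.2 x)‖ / ‖c i.2 x‖ ^ 2)) ^ 2 ≤
      ∑ τ, m τ / ‖c τ x‖ ^ 2 * ‖c τ z‖ ^ 2 := by
    rw [Fintype.sum_prod_type, Finset.sum_comm]
    refine Finset.sum_le_sum fun τ _ => ?_
    have h1 : ∀ σ, (√(α σ τ) * (‖inner ℂ z (c τ x)‖ / ‖c τ x‖ ^ 2)) ^ 2 =
        α σ τ * (‖inner ℂ z (c τ x)‖ / ‖c τ x‖ ^ 2) ^ 2 := fun σ => by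
      rw [mul_pow, Real.sq_sqrt (hα σ τ)]
    simp only [h1]
    rw [← Finset.sum_mul, hm]
    have hm0 : 0 ≤ m τ := hm τ ▸ Finset.sum_nonneg fun σ _ => hα σ τ
    have h2 : ‖inner ℂ z (c τ x)‖ ≤ ‖c τ z‖ * ‖c τ x‖ := by
      rw [← (hc.proj τ).apply_apply x, ← (hc.proj τ).inner_left, (hc.proj τ).apply_apply]
      exact norm_inner_le_norm _ _
    by_cases h3 : ‖c τ x‖ = 0
    · rw [h3]; simp
    · have h4 : 0 < ‖c τ x‖ := lt_of_le_of_ne (norm_nonneg _) (Ne.symm h3)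
      calc m τ * (‖inner ℂ z (c τ x)‖ / ‖c τ x‖ ^ 2) ^ 2
          ≤ m τ * (‖c τ z‖ * ‖c τ x‖ / ‖c τ x‖ ^ 2) ^ 2 := by gcongr
        _ = m τ / ‖c τ x‖ ^ 2 * ‖c τ z‖ ^ 2 := by field_simp
  calc ‖inner ℂ z (couplingOp c d x w α y)‖ ^ 2 ≤ _ := pow_le_pow_left₀ (norm_nonneg _) hb 2
    _ ≤ _ := hcs
    _ ≤ _ := mul_le_mul hfirst hsecond (Finset.sum_nonneg fun i _ => sq_nonneg _) (sq_nonneg _)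

/-- Corners of a coupling operator vanish where the matrix does. -/
theorem inner_couplingOp_eq_zero {e : H →L[ℂ] H} {f : K →L[ℂ] K} (hf : IsStarProjection f)
    (h : ∀ σ τ, α σ τ = 0 ∨ f (d σ w) = 0 ∨ e (c τ x) = 0) (y : K) :
    e (couplingOp c d x w α (f y)) = 0 := by
  rw [couplingOp_apply, map_sum]
  refine Finset.sum_eq_zero fun σ _ => ?_
  rw [map_sum]
  refine Finset.sum_eq_zero fun τ _ => ?_
  rw [map_smul, map_smul, ← hf.inner_left]
  rcases h σ τ with h | h | h <;> simp [h]

end Coupling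

open Filter Topology in
/-- Bounded families of operators converge along ultrafilters in the weak operator topology. -/
theorem Ultrafilter.exists_tendsto_inner {ι H K : Type*} [NormedAddCommGroup H]
    [InnerProductSpace ℂ H] [NormedAddCommGroup K] [InnerProductSpace ℂ K] [CompleteSpace K]
    (𝒰 : Ultrafilter ι) (f : ι → H →L[ℂ] K) (hf : ∀ i, ‖f i‖ ≤ 1) :
    ∃ T : H →L[ℂ] K, ∀ x y, Tendsto (fun i => inner ℂ y (f i x)) 𝒰 (𝓝 (inner ℂ y (T x))) := by
  have hfx : ∀ i x, ‖f i x‖ ≤ ‖x‖ := fun i x => by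
    simpa using (f i).le_of_opNorm_le (hf i) x
  have hlim : ∀ x y, ∃ z : ℂ, ‖z‖ ≤ ‖x‖ * ‖y‖ ∧ Tendsto (fun i => inner ℂ (f i x) y) 𝒰 (𝓝 z) := by
    intro x y
    obtain ⟨z, hz, hle⟩ := (isCompact_closedBall (0 : ℂ) (‖x‖ * ‖y‖)).ultrafilter_le_nhds
      (𝒰.map fun i => inner ℂ (f i x) y) (by
        rw [le_principal_iff, Ultrafilter.coe_map, Filter.mem_map]
        refine univ_mem' fun i => ?_
        simp only [Set.mem_preimage, mem_closedBall_zero_iff]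
        exact (norm_inner_le_norm _ _).trans (by gcongr; exact hfx i x))
    exact ⟨z, by simpa using hz, hle⟩
  choose B hB hBlim using hlim
  have hadd : ∀ x y y', B x (y + y') = B x y + B x y' := fun x y y' =>
    tendsto_nhds_unique (hBlim x (y + y')) (by
      simp only [inner_add_right]; exact (hBlim x y).add (hBlim x y'))
  have hsmul : ∀ (c : ℂ) x y, B x (c • y) = c * B x y := fun c x y =>
    tendsto_nhds_unique (hBlim x (c • y)) (by
      simp only [inner_smul_right]; exact (hBlim x y).const_mul c)
  let ℓ : H → StrongDual ℂ K := fun x => LinearMap.mkContinuous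
    { toFun := B x, map_add' := hadd x, map_smul' := fun c y => hsmul c x y } ‖x‖ (hB x)
  let T₀ : H → K := fun x => (InnerProductSpace.toDual ℂ K).symm (ℓ x)
  have hT₀ : ∀ x y, inner ℂ (T₀ x) y = B x y := fun x y =>
    InnerProductSpace.toDual_symm_apply
  let T : H →L[ℂ] K := LinearMap.mkContinuous
    { toFun := T₀
      map_add' := fun x x' => by
        refine ext_inner_right ℂ fun y => ?_
        rw [inner_add_left, hT₀, hT₀, hT₀]
        refine tendsto_nhds_unique (hBlim (x + x') y) ?_
        simp only [map_add, inner_add_left]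
        exact (hBlim x y).add (hBlim x' y)
      map_smul' := fun c x => by
        refine ext_inner_right ℂ fun y => ?_
        rw [RingHom.id_apply, inner_smul_left, hT₀, hT₀]
        refine tendsto_nhds_unique (hBlim (c • x) y) ?_
        simp only [map_smul, inner_smul_left]
        exact (hBlim x y).const_mul _ } 1 (fun x => by
      rw [one_mul]
      have h1 := hB x (T₀ x)
      rw [← hT₀, inner_self_eq_norm_sq_to_K] at h1
      simp only [norm_pow] at h1
      change ‖T₀ x‖ ≤ ‖x‖
      have h2 : ‖((‖T₀ x‖ : ℝ) : ℂ)‖ = ‖T₀ x‖ := by simp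
      have h3 : ‖T₀ x‖ ^ 2 ≤ ‖x‖ * ‖T₀ x‖ := by
        rw [← h2]; simpa using h1
      by_contra! h
      have := norm_nonneg x
      nlinarith)
  refine ⟨T, fun x y => ?_⟩
  have h1 := (Complex.continuous_conj.tendsto _).comp (hBlim x y)
  rw [← hT₀] at h1
  have h2 : Tendsto (fun i => inner ℂ y (f i x)) 𝒰 (𝓝 (inner ℂ y (T₀ x))) := by
    simpa [Function.comp_def] using h1
  exact h2

theorem nonneg_of_inner {H : Type*} [NormedAddCommGroup H] [InnerProductSpace ℂ H]
    {A : H →L[ℂ] H} (him : ∀ z, (inner ℂ z (A z)).im = 0)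
    (hre : ∀ z, 0 ≤ (inner ℂ z (A z)).re) : 0 ≤ A := by
  rw [ContinuousLinearMap.nonneg_iff_isPositive, ContinuousLinearMap.isPositive_iff_complex]
  intro z
  have h1 : inner ℂ (A z) z = ((inner ℂ z (A z)).re : ℂ) := by
    rw [← inner_conj_symm]
    apply Complex.ext <;> simp only [Complex.conj_re, Complex.conj_im, Complex.ofReal_re,
      Complex.ofReal_im, him, neg_zero]
  rw [h1]
  exact ⟨by simp, by simpa using hre z⟩

/-! ### Flows of operators and near-identity contractions at one vector -/

section Core

variable {Λ H K : Type*} [Lattice Λ] [BoundedOrder Λ]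
  [NormedAddCommGroup H] [InnerProductSpace ℂ H] [CompleteSpace H]
  [NormedAddCommGroup K] [InnerProductSpace ℂ K] [CompleteSpace K]

/-- Operators which realize a flow from `w` through `x` to `w` compatible with the lattice
elements in `s`. -/
structure IsFlow (p : Λ → H →L[ℂ] H) (q : Λ → K →L[ℂ] K) (x : H) (w : K) (ε : ℝ) (s : Set Λ)
    (S T : K →L[ℂ] H) (h : H →L[ℂ] H) : Prop where
  left_corner : ∀ a ∈ s, ∀ y, (1 - p a) (S (q a y)) = 0
  right_corner : ∀ a ∈ s, ∀ y, p a (T ((1 - q a) y)) = 0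
  comm : ∀ a ∈ s, ∀ z, p a (h z) = h (p a z)
  left_bound : ∀ y z, ‖inner ℂ z (S y)‖ ^ 2 ≤ ‖y‖ ^ 2 * (inner ℂ z (h z)).re
  right_bound : ∀ y z, ‖inner ℂ z (T y)‖ ^ 2 ≤ ‖y‖ ^ 2 * (inner ℂ z (h z)).re
  left_apply : S w = h x
  right_apply : T w = h x
  im_eq_zero : ∀ z, (inner ℂ z (h z)).im = 0
  re_nonneg : ∀ z, 0 ≤ (inner ℂ z (h z)).re
  re_le : ∀ z, (inner ℂ z (h z)).re ≤ ‖z‖ ^ 2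
  mass : ‖w‖ ^ 2 - ε ≤ (inner ℂ x (h x)).re

namespace IsFlow

variable {p : Λ → H →L[ℂ] H} {q : Λ → K →L[ℂ] K} {x : H} {w : K} {ε : ℝ} {s : Set Λ}
  {S T : K →L[ℂ] H} {h : H →L[ℂ] H}

theorem norm_le_one_of_bound {R : K →L[ℂ] H}
    (hR : ∀ y z, ‖inner ℂ z (R y)‖ ^ 2 ≤ ‖y‖ ^ 2 * (inner ℂ z (h z)).re)
    (re_le : ∀ z, (inner ℂ z (h z)).re ≤ ‖z‖ ^ 2) : ‖R‖ ≤ 1 := by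
  refine R.opNorm_le_bound zero_le_one fun y => ?_
  have h1 := (hR y (R y)).trans (mul_le_mul_of_nonneg_left (re_le (R y)) (sq_nonneg _))
  have h2 : ‖inner ℂ (R y) (R y)‖ = ‖R y‖ ^ 2 := by
    rw [inner_self_eq_norm_sq_to_K]; simp
  rw [h2, ← mul_pow] at h1
  have h3 := le_of_sq_le_sq h1 (by positivity)
  by_contra! h4
  have := norm_nonneg y
  nlinarith

theorem nonneg (hf : IsFlow p q x w ε s S T h) : 0 ≤ h :=
  nonneg_of_inner hf.im_eq_zero hf.re_nonneg

theorem le_one (hf : IsFlow p q x w ε s S T h) : h ≤ 1 := by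
  rw [← sub_nonneg]
  have h3 : ∀ z, (inner ℂ z ((1 - h) z)) = ((‖z‖ ^ 2 : ℝ) : ℂ) - inner ℂ z (h z) := fun z => by
    rw [sub_apply, inner_sub_right, one_apply_eq_self, inner_self_eq_norm_sq_to_K]; simp
  refine nonneg_of_inner (fun z => ?_) fun z => ?_
  · rw [h3, Complex.sub_im, Complex.ofReal_im, hf.im_eq_zero, sub_zero]
  · rw [h3, Complex.sub_re, Complex.ofReal_re]
    linarith [hf.re_le z]

theorem norm_le_one (hf : IsFlow p q x w ε s S T h) : ‖h‖ ≤ 1 :=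
  (CStarAlgebra.norm_le_one_iff_of_nonneg h hf.nonneg).mpr hf.le_one

/-- Flows for a finite set of lattice elements. -/
theorem exists_of_finset (hp : IsLatticeRep p) (hq : IsLatticeRep q)
    (hdom : ∀ a b, a ≤ b → ‖q b w‖ ^ 2 - ‖q a w‖ ^ 2 ≤ ‖p b x‖ ^ 2 - ‖p a x‖ ^ 2 + ε)
    (s : Finset Λ) : ∃ S T h, IsFlow p q x w ε s S T h := by
  classical
  -- Cells are indexed by subsets of `s` ordered by inclusion. An upper set of indices corresponds
  -- to a join of meets, so domination on the lattice becomes the cut condition for the masses of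
  -- `w` and `x` in the cells.
  let Ω := {σ // σ ∈ s.powerset}
  let c : Ω → H →L[ℂ] H := fun σ => latticeCell p s σ.1
  let d : Ω → K →L[ℂ] K := fun σ => latticeCell q s σ.1
  have hc : IsPartitionOfUnity c :=
    ⟨fun σ => hp.isStarProjection_cell _ _, fun σ τ h => hp.cell_mul_cell
      (Finset.mem_powerset.mp σ.2) (Finset.mem_powerset.mp τ.2) (fun h' => h (Subtype.ext h')),
      by rw [← hp.sum_cell s, ← Finset.sum_attach s.powerset]; rfl⟩
  have hd : IsPartitionOfUnity d :=
    ⟨fun σ => hq.isStarProjection_cell _ _, fun σ τ h => hq.cell_mul_cell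
      (Finset.mem_powerset.mp σ.2) (Finset.mem_powerset.mp τ.2) (fun h' => h (Subtype.ext h')),
      by rw [← hq.sum_cell s, ← Finset.sum_attach s.powerset]; rfl⟩
  obtain ⟨α, β, hα, hβ, hα0, hβ0, hαr, hβr, hαc, hβc, htot⟩ := exists_chain_flow
    (fun σ => ‖d σ w‖ ^ 2) (fun σ => ‖c σ x‖ ^ 2) (fun _ => sq_nonneg _) (fun _ => sq_nonneg _)
    (ε := ε) (by
      intro U U' hU hU' hUU'
      rw [IsPartitionOfUnity.norm_sq_sum hd.proj (hq.proj _) (hq.map_sup_inf_eq_sum_cell s U hU),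
        IsPartitionOfUnity.norm_sq_sum hd.proj (hq.proj _) (hq.map_sup_inf_eq_sum_cell s U' hU'),
        IsPartitionOfUnity.norm_sq_sum hc.proj (hp.proj _) (hp.map_sup_inf_eq_sum_cell s U hU),
        IsPartitionOfUnity.norm_sq_sum hc.proj (hp.proj _) (hp.map_sup_inf_eq_sum_cell s U' hU')]
      exact hdom _ _ (Finset.sup_mono hUU'))
  let m : Ω → ℝ := fun τ => ∑ σ, α σ τ
  have hm0 : ∀ τ, 0 ≤ m τ := fun τ => Finset.sum_nonneg fun σ _ => hα σ τ
  have hinner : ∀ z, inner ℂ z (densityOp c x m z) =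
      ((∑ τ, m τ / ‖c τ x‖ ^ 2 * ‖c τ z‖ ^ 2 : ℝ) : ℂ) := by
    intro z
    rw [← inner_conj_symm, re_inner_densityOp hc, Complex.conj_ofReal]
  refine ⟨couplingOp c d x w α, couplingOp c d x w β, densityOp c x m, ?_, ?_, ?_, ?_, ?_, ?_, ?_,
    ?_, ?_, ?_, ?_⟩
  -- The range of `q a` consists of the cells whose index contains `a`, and `α` moves mass only to
  -- larger indices. In the next corner `β` goes to smaller ones, so cells not containing `a` are
  -- preserved.
  · intro a ha y
    refine inner_couplingOp_eq_zero (hq.proj a) (fun σ τ => ?_) y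
    by_cases hσ : a ∈ σ.1
    · by_cases hτ : a ∈ τ.1
      · refine Or.inr (Or.inr ?_)
        have : (1 - p a) * c τ = 0 := by
          rw [sub_mul, one_mul, hp.mul_cell_of_mem hτ, sub_self]
        exact DFunLike.congr_fun this x
      · exact Or.inl (hα0 σ τ fun h => hτ (h hσ))
    · exact Or.inr (Or.inl (DFunLike.congr_fun (hq.mul_cell_of_notMem ha hσ) w))
  · intro a ha y
    refine inner_couplingOp_eq_zero (hq.proj a).one_sub (fun σ τ => ?_) y
    by_cases hτ : a ∈ τ.1
    · by_cases hσ : a ∈ σ.1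
      · refine Or.inr (Or.inl ?_)
        have : (1 - q a) * d σ = 0 := by
          rw [sub_mul, one_mul, hq.mul_cell_of_mem hσ, sub_self]
        exact DFunLike.congr_fun this w
      · exact Or.inl (hβ0 σ τ fun h => hσ (h hτ))
    · exact Or.inr (Or.inr (DFunLike.congr_fun (hp.mul_cell_of_notMem ha hτ) x))
  · intro a _ z
    rw [densityOp_apply, densityOp_apply, map_sum]
    refine Finset.sum_congr rfl fun τ _ => ?_
    rw [map_smul]
    congr 1
    exact DFunLike.congr_fun (hp.commute_cell a s τ.1).eq z
  · intro y z
    rw [hinner, Complex.ofReal_re]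
    exact norm_inner_couplingOp_sq_le hc hd hα hαr (fun _ => rfl) y z
  · intro y z
    rw [hinner, Complex.ofReal_re]
    exact norm_inner_couplingOp_sq_le hc hd hβ hβr hβc y z
  · exact couplingOp_apply_self hd hα hαr (fun _ => rfl)
  · exact couplingOp_apply_self hd hβ hβr hβc
  · intro z
    rw [hinner, Complex.ofReal_im]
  · intro z
    rw [hinner, Complex.ofReal_re]
    exact Finset.sum_nonneg fun τ _ =>
      mul_nonneg (div_nonneg (hm0 τ) (sq_nonneg _)) (sq_nonneg _)
  · intro z
    rw [hinner, Complex.ofReal_re, ← hc.sum_norm_sq z]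
    refine Finset.sum_le_sum fun τ _ => ?_
    exact mul_le_of_le_one_left (sq_nonneg _) (div_le_one_of_le₀ (hαc τ) (sq_nonneg _))
  · rw [hinner, Complex.ofReal_re, ← hd.sum_norm_sq w]
    refine htot.trans (Finset.sum_le_sum fun τ _ => ?_)
    by_cases h : ‖c τ x‖ ^ 2 = 0
    · exact ((hαc τ).trans h.le).trans (by rw [h, mul_zero])
    · rw [div_mul_cancel₀ _ h]

open Filter Topology in
/-- Flows for a whole lattice, by compactness. -/
theorem exists_univ (hp : IsLatticeRep p) (hq : IsLatticeRep q)
    (hdom : ∀ a b, a ≤ b → ‖q b w‖ ^ 2 - ‖q a w‖ ^ 2 ≤ ‖p b x‖ ^ 2 - ‖p a x‖ ^ 2 + ε) :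
    ∃ S T h, IsFlow p q x w ε Set.univ S T h := by
  choose S T h hf using exists_of_finset hp hq hdom
  let 𝒰 : Ultrafilter (Finset Λ) := Ultrafilter.of atTop
  have h𝒰 : ∀ a, ∀ᶠ s : Finset Λ in 𝒰, a ∈ (s : Set Λ) := fun a =>
    (Ultrafilter.of_le atTop) ((eventually_ge_atTop {a}).mono fun s hs =>
      Finset.singleton_subset_iff.mp hs)
  obtain ⟨S', hS'⟩ := 𝒰.exists_tendsto_inner S fun s =>
    norm_le_one_of_bound (hf s).left_bound (hf s).re_le
  obtain ⟨T', hT'⟩ := 𝒰.exists_tendsto_inner T fun s =>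
    norm_le_one_of_bound (hf s).right_bound (hf s).re_le
  obtain ⟨h', hh'⟩ := 𝒰.exists_tendsto_inner h fun s => (hf s).norm_le_one
  have hre : ∀ z, Tendsto (fun s => (inner ℂ z (h s z)).re) 𝒰 (𝓝 (inner ℂ z (h' z)).re) :=
    fun z => (Complex.continuous_re.tendsto _).comp (hh' z z)
  refine ⟨S', T', h', ?_, ?_, ?_, ?_, ?_, ?_, ?_, ?_, ?_, ?_, ?_⟩
  · intro a _ y
    refine ext_inner_left ℂ fun z => ?_
    rw [← (hp.proj a).one_sub.inner_left, inner_zero_right]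
    refine tendsto_nhds_unique (hS' (q a y) ((1 - p a) z)) (tendsto_const_nhds.congr' ?_)
    filter_upwards [h𝒰 a] with s hs
    rw [(hp.proj a).one_sub.inner_left, (hf s).left_corner a hs, inner_zero_right]
  · intro a _ y
    refine ext_inner_left ℂ fun z => ?_
    rw [← (hp.proj a).inner_left, inner_zero_right]
    refine tendsto_nhds_unique (hT' ((1 - q a) y) (p a z)) (tendsto_const_nhds.congr' ?_)
    filter_upwards [h𝒰 a] with s hs
    rw [(hp.proj a).inner_left, (hf s).right_corner a hs, inner_zero_right]
  · intro a _ y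
    refine ext_inner_left ℂ fun z => ?_
    rw [← (hp.proj a).inner_left]
    refine tendsto_nhds_unique (hh' y (p a z)) ((hh' (p a y) z).congr' ?_)
    filter_upwards [h𝒰 a] with s hs
    rw [(hp.proj a).inner_left, (hf s).comm a hs]
  · intro y z
    exact le_of_tendsto_of_tendsto' ((hS' y z).norm.pow 2) ((hre z).const_mul _)
      fun s => (hf s).left_bound y z
  · intro y z
    exact le_of_tendsto_of_tendsto' ((hT' y z).norm.pow 2) ((hre z).const_mul _)
      fun s => (hf s).right_bound y z
  · refine ext_inner_left ℂ fun z => tendsto_nhds_unique (hS' w z) ?_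
    simpa only [(hf _).left_apply] using hh' x z
  · refine ext_inner_left ℂ fun z => tendsto_nhds_unique (hT' w z) ?_
    simpa only [(hf _).right_apply] using hh' x z
  · intro z
    refine tendsto_nhds_unique ((Complex.continuous_im.tendsto _).comp (hh' z z)) ?_
    simp only [Function.comp_def, (hf _).im_eq_zero]
    exact tendsto_const_nhds
  · exact fun z => ge_of_tendsto' (hre z) fun s => (hf s).re_nonneg z
  · exact fun z => le_of_tendsto' (hre z) fun s => (hf s).re_le z
  · exact ge_of_tendsto' (hre x) fun s => (hf s).mass

end IsFlow

/-- The operators which map the range of `p a` into the range of `q a` for all `a`. -/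
def intertwiners (p : Λ → H →L[ℂ] H) (q : Λ → K →L[ℂ] K) : Submodule ℂ (H →L[ℂ] K) where
  carrier := {T | ∀ a, (1 - q a) ∘L T ∘L p a = 0}
  add_mem' {S T} hS hT a := by
    rw [ContinuousLinearMap.add_comp, ContinuousLinearMap.comp_add, hS a, hT a, add_zero]
  zero_mem' a := by simp
  smul_mem' c T hT a := by
    rw [ContinuousLinearMap.smul_comp, ContinuousLinearMap.comp_smul, hT a, smul_zero]

theorem mem_intertwiners {p : Λ → H →L[ℂ] H} {q : Λ → K →L[ℂ] K} {T : H →L[ℂ] K} :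
    T ∈ intertwiners p q ↔ ∀ a x, (1 - q a) (T (p a x)) = 0 :=
  forall_congr' fun _ => ContinuousLinearMap.ext_iff

-- Formally `T* h⁻¹ S` is a contraction, as `S` and `T` are both `h^(1/2)` times contractions, and
-- its value at `w` is `⟪h x, h⁻¹ h x⟫ = ⟪x, h x⟫ ≥ ‖w‖² - ε`. Replacing `h⁻¹` by `k = (δ + h)⁻¹`
-- makes this rigorous at the cost `δ ‖x‖²`. Since `h` commutes with `p`, so does `k`, and `T* k` is
-- an intertwiner.
open scoped ComplexOrder in
theorem exists_intertwiners_of_dominated {p : Λ → H →L[ℂ] H} {q : Λ → K →L[ℂ] K}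
    (hp : IsLatticeRep p) (hq : IsLatticeRep q) {x : H} {w : K} {ε : ℝ}
    (hdom : ∀ a b, a ≤ b → ‖q b w‖ ^ 2 - ‖q a w‖ ^ 2 ≤ ‖p b x‖ ^ 2 - ‖p a x‖ ^ 2 + ε)
    {δ : ℝ} (hδ : 0 < δ) :
    ∃ S ∈ intertwiners q p, ∃ T ∈ intertwiners p q, ‖T ∘L S‖ ≤ 1 ∧
      ‖w‖ ^ 2 - ε - δ * ‖x‖ ^ 2 ≤ (inner ℂ w (T (S w))).re := by
  obtain ⟨S, T, h, hf⟩ := IsFlow.exists_univ hp hq hdom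
  have hpos := (ContinuousLinearMap.nonneg_iff_isPositive h).mp hf.nonneg
  have hunit : IsUnit ((δ : ℂ) • (1 : H →L[ℂ] H) + h) := by
    refine CStarAlgebra.isUnit_of_le ((δ : ℂ) • (1 : H →L[ℂ] H)) (by simpa using hf.nonneg) ?_
    exact IsStrictlyPositive.smul (by exact_mod_cast hδ) isStrictlyPositive_one
  obtain ⟨u, hu⟩ := hunit
  set k : H →L[ℂ] H := ((u⁻¹ : (H →L[ℂ] H)ˣ) : H →L[ℂ] H) with hk
  have huk : ∀ z, (δ : ℂ) • k z + h (k z) = z := fun z => by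
    have := DFunLike.congr_fun (u.mul_inv) z
    rw [hu] at this
    exact this
  have hku : ∀ z, (δ : ℂ) • k z + k (h z) = z := fun z => by
    have := DFunLike.congr_fun (u.inv_mul) z
    rw [hu] at this
    simpa using this
  have hkp : ∀ a, Commute (p a) k := fun a => by
    refine Commute.units_inv_right ?_
    rw [hu]
    refine ((Commute.one_right _).smul_right _).add_right ?_
    exact ContinuousLinearMap.ext fun z => hf.comm a trivial z
  have hhsymm : ∀ y z, inner ℂ (h y) z = inner ℂ y (h z) := hpos.isSymmetric
  have hksymm : ∀ y z, inner ℂ (k y) z = inner ℂ y (k z) := by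
    intro y z
    conv_lhs => rw [← huk z]
    conv_rhs => rw [← huk y]
    rw [inner_add_right, inner_add_left, inner_smul_left, inner_smul_right, Complex.conj_ofReal,
      hhsymm]
  have hkre : ∀ z, (inner ℂ (k z) z).re = δ * ‖k z‖ ^ 2 + (inner ℂ (k z) (h (k z))).re := by
    intro z
    conv_lhs => rw [← huk z]
    rw [huk z]
    conv_lhs => rw [← huk z, inner_add_right, inner_smul_right, huk z, inner_self_eq_norm_sq_to_K]
    simp [← Complex.ofReal_pow]
  have hkle : ∀ z, (inner ℂ (k z) (h (k z))).re ≤ (inner ℂ (k z) z).re := fun z => by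
    rw [hkre]; nlinarith [sq_nonneg ‖k z‖]
  have hk0 : ∀ z, 0 ≤ (inner ℂ (k z) z).re := fun z => (hf.re_nonneg _).trans (hkle z)
  refine ⟨S, ?_, ContinuousLinearMap.adjoint T ∘L k, ?_, ?_, ?_⟩
  · exact mem_intertwiners.mpr fun a y => hf.left_corner a trivial y
  · refine mem_intertwiners.mpr fun a y => ?_
    refine ext_inner_right ℂ fun z => ?_
    rw [(hq.proj a).one_sub.inner_left, ContinuousLinearMap.comp_apply,
      ContinuousLinearMap.adjoint_inner_left, inner_zero_left]
    have : k (p a y) = p a (k y) := (DFunLike.congr_fun (hkp a).eq y).symm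
    rw [this, (hp.proj a).inner_left, hf.right_corner a trivial, inner_zero_right]
  -- Apply both flow bounds at `z = k (T y')`. With `r = re ⟪z, T y'⟫`, the bound on `T` gives `r² ≤
  -- ‖y'‖² r`, hence `r ≤ ‖y'‖²`; the bound on `S` then gives the claim.
  · have hb : ∀ y y', ‖inner ℂ y' ((ContinuousLinearMap.adjoint T ∘L k ∘L S) y)‖ ≤ ‖y'‖ * ‖y‖ := by
      intro y y'
      have e1 : inner ℂ y' ((ContinuousLinearMap.adjoint T ∘L k ∘L S) y) =
          inner ℂ (k (T y')) (S y) := by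
        rw [ContinuousLinearMap.comp_apply, ContinuousLinearMap.adjoint_inner_right,
          ContinuousLinearMap.comp_apply, hksymm]
      have h1 := hf.left_bound y (k (T y'))
      have h2 := hf.right_bound y' (k (T y'))
      have h3 := hkle (T y')
      have h4 := hk0 (T y')
      set r := (inner ℂ (k (T y')) (T y')).re with hr
      have h5 : r ^ 2 ≤ ‖inner ℂ (k (T y')) (T y')‖ ^ 2 := by
        rw [← sq_abs]; exact pow_le_pow_left₀ (abs_nonneg _) (Complex.abs_re_le_norm _) 2
      have h6 : r ≤ ‖y'‖ ^ 2 := by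
        have : r * r ≤ ‖y'‖ ^ 2 * r := by
          nlinarith [mul_le_mul_of_nonneg_left h3 (sq_nonneg ‖y'‖)]
        rcases h4.eq_or_lt with h0 | h0
        · rw [← h0]; positivity
        · exact le_of_mul_le_mul_right this h0
      rw [e1]
      refine le_of_sq_le_sq (h1.trans ?_) (by positivity)
      rw [mul_pow, mul_comm]
      exact mul_le_mul_of_nonneg_right (h3.trans h6) (sq_nonneg _)
    refine ContinuousLinearMap.opNorm_le_bound _ zero_le_one fun y => ?_
    have h1 := hb y ((ContinuousLinearMap.adjoint T ∘L k ∘L S) y)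
    rw [inner_self_eq_norm_sq_to_K] at h1
    simp only [norm_pow] at h1
    set A := (ContinuousLinearMap.adjoint T ∘L k ∘L S) y with hA
    have h2 : ‖((‖A‖ : ℝ) : ℂ)‖ = ‖A‖ := by simp
    have h3 : ‖A‖ ^ 2 ≤ ‖A‖ * ‖y‖ := by
      rw [← h2]; simpa using h1
    change ‖A‖ ≤ 1 * ‖y‖
    by_contra! h
    have := norm_nonneg y
    nlinarith
  · have e1 : inner ℂ w ((ContinuousLinearMap.adjoint T ∘L k) (S w)) =
        inner ℂ (h x) (k (h x)) := by
      rw [ContinuousLinearMap.comp_apply, ContinuousLinearMap.adjoint_inner_right,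
        hf.left_apply, hf.right_apply]
    have e2 : inner ℂ x (h x) = (δ : ℂ) * inner ℂ x (k (h x)) + inner ℂ (h x) (k (h x)) := by
      conv_lhs => rw [← huk (h x), inner_add_right, inner_smul_right, ← hhsymm]
    have e3 : inner ℂ x (k (h x)) = ((‖x‖ ^ 2 : ℝ) : ℂ) - (δ : ℂ) * inner ℂ x (k x) := by
      have : k (h x) = x - (δ : ℂ) • k x := by
        rw [eq_sub_iff_add_eq, add_comm]; exact hku x
      rw [this, inner_sub_right, inner_smul_right, inner_self_eq_norm_sq_to_K]; simp
    have e4 : 0 ≤ (inner ℂ x (k x)).re := by rw [← hksymm]; exact hk0 x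
    have e5 : (inner ℂ x (k (h x))).re ≤ ‖x‖ ^ 2 := by
      rw [e3, Complex.sub_re, Complex.ofReal_re, Complex.re_ofReal_mul]
      nlinarith
    have e6 := congrArg Complex.re e2
    rw [Complex.add_re, Complex.re_ofReal_mul] at e6
    rw [e1]
    have := hf.mass
    nlinarith

end Core

/-! ### Finite amplifications -/

section Amplification

variable {H ι : Type*} [Fintype ι] [NormedAddCommGroup H] [InnerProductSpace ℂ H]

/-- The diagonal operator on a finite direct sum of copies of `H`. -/
noncomputable def diagOp (ι : Type*) [Fintype ι] (A : H →L[ℂ] H) :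
    PiLp 2 (fun _ : ι => H) →L[ℂ] PiLp 2 (fun _ : ι => H) :=
  ((PiLp.continuousLinearEquiv 2 ℂ (fun _ : ι => H)).symm : _ →L[ℂ] _) ∘L
    ContinuousLinearMap.pi fun i => A ∘L PiLp.proj 2 (fun _ : ι => H) i

theorem diagOp_apply (A : H →L[ℂ] H) (v : PiLp 2 (fun _ : ι => H)) (i : ι) :
    diagOp ι A v i = A (v i) := rfl

/-- The inclusion of a summand into a finite direct sum of copies of `H`. -/
noncomputable def inclOp [DecidableEq ι] (i : ι) : H →L[ℂ] PiLp 2 (fun _ : ι => H) :=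
  ((PiLp.continuousLinearEquiv 2 ℂ (fun _ : ι => H)).symm : _ →L[ℂ] _) ∘L
    ContinuousLinearMap.single ℂ (fun _ : ι => H) i

theorem inclOp_apply [DecidableEq ι] (i : ι) (x : H) (j : ι) :
    inclOp i x j = (Pi.single i x : ι → H) j := rfl

theorem sum_inclOp [DecidableEq ι] (v : PiLp 2 (fun _ : ι => H)) :
    ∑ i, inclOp i (v i) = v := by
  ext j
  rw [WithLp.ofLp_sum, Finset.sum_apply]
  simp [inclOp_apply, Pi.single_apply]

theorem diagOp_inclOp [DecidableEq ι] (A : H →L[ℂ] H) (i : ι) (x : H) :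
    diagOp ι A (inclOp i x) = inclOp i (A x) := by
  ext j
  rw [diagOp_apply, inclOp_apply, inclOp_apply]
  by_cases h : j = i
  · subst h; simp
  · simp [h]

theorem IsLatticeRep.diagOp [CompleteSpace H] {Λ : Type*} [Lattice Λ] [BoundedOrder Λ]
    {p : Λ → H →L[ℂ] H} (hp : IsLatticeRep p) (ι : Type*) [Fintype ι] :
    IsLatticeRep fun a => diagOp ι (p a) where
  proj a := by
    refine ⟨?_, ?_⟩
    · ext v i
      exact (hp.proj a).apply_apply (v i)
    · rw [ContinuousLinearMap.isSelfAdjoint_iff_isSymmetric]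
      intro v w
      change inner ℂ (_root_.diagOp ι (p a) v) w = inner ℂ v (_root_.diagOp ι (p a) w)
      rw [PiLp.inner_apply, PiLp.inner_apply]
      exact Finset.sum_congr rfl fun i _ => (hp.proj a).inner_left _ _
  map_inf a b := by
    ext v i
    exact DFunLike.congr_fun (hp.map_inf a b) (v i)
  map_sup a b := by
    ext v i
    exact DFunLike.congr_fun (hp.map_sup a b) (v i)
  map_top := by
    ext v i
    exact DFunLike.congr_fun hp.map_top (v i)
  map_bot := by
    ext v i
    exact DFunLike.congr_fun hp.map_bot (v i)

end Amplification

/-! ### Normal representations and bounded approximate identities -/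

/-- Lattice representations which are continuous along directed sets. -/
structure IsNormalRep {Λ H : Type*} [CompleteLattice Λ] [NormedAddCommGroup H]
    [InnerProductSpace ℂ H] [CompleteSpace H] (p : Λ → H →L[ℂ] H) : Prop
    extends IsLatticeRep p where
  normal : ∀ x, IsNormalModular fun a => ‖p a x‖ ^ 2

theorem IsNormalModular.dual {Λ : Type*} [CompleteLattice Λ] {F : Λ → ℝ} (hF : IsNormalModular F) :
    IsNormalModular (Γ := Λᵒᵈ) fun a => F (OrderDual.ofDual a) where
  modular a b := by
    rw [ofDual_sup, ofDual_inf, add_comm]; exact hF.modular _ _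
  tendsto_sSup D hD h := hF.tendsto_sInf (OrderDual.toDual ⁻¹' D) hD h
  tendsto_sInf D hD h := hF.tendsto_sSup (OrderDual.toDual ⁻¹' D) hD h

theorem isNormalModular_const {Λ : Type*} [CompleteLattice Λ] (c : ℝ) :
    IsNormalModular fun _ : Λ => c :=
  ⟨fun _ _ => rfl, fun _ _ _ => tendsto_const_nhds, fun _ _ _ => tendsto_const_nhds⟩

theorem IsNormalRep.dual {Λ H : Type*} [CompleteLattice Λ] [NormedAddCommGroup H]
    [InnerProductSpace ℂ H] [CompleteSpace H] {p : Λ → H →L[ℂ] H} (hp : IsNormalRep p) :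
    IsNormalRep (Λ := Λᵒᵈ) fun a => 1 - p (OrderDual.ofDual a) where
  toIsLatticeRep := hp.toIsLatticeRep.dual
  normal x := by
    have h1 := (isNormalModular_const (‖x‖ ^ 2)).sub (hp.normal x).dual
    have h2 : (fun a : Λᵒᵈ => ‖(1 - p (OrderDual.ofDual a)) x‖ ^ 2) =
        fun a => ‖x‖ ^ 2 - ‖p (OrderDual.ofDual a) x‖ ^ 2 := by
      ext a
      rw [(hp.proj (OrderDual.ofDual a)).norm_sq_add x]; ring
    rw [h2]; exact h1

section Approximation

variable {Λ H K : Type*} [CompleteLattice Λ]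
  [NormedAddCommGroup H] [InnerProductSpace ℂ H] [CompleteSpace H]
  [NormedAddCommGroup K] [InnerProductSpace ℂ K] [CompleteSpace K]

/-- The span of the products of intertwiners from `p` to `q` and from `q` to `p`. -/
def compSpan (p : Λ → H →L[ℂ] H) (q : Λ → K →L[ℂ] K) : Submodule ℂ (K →L[ℂ] K) :=
  Submodule.span ℂ (opMul (intertwiners p q : Set (H →L[ℂ] K)) (intertwiners q p : Set (K →L[ℂ] H)))

variable {p : Λ → H →L[ℂ] H} {q : Λ → K →L[ℂ] K}

/-- Domination by finitely many vectors with multiplicity `n` is domination by one vector of an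
amplification of `p`. A factorization through a finite direct sum of copies of `H` is a finite sum
of factorizations through `H`, so the contraction obtained lies in the span. -/
theorem exists_compSpan_near (hp : IsNormalRep p) (hq : IsNormalRep q)
    (hsep : ∀ a b, p a = p b → q a = q b) (w : K) {ε : ℝ} (hε : 0 < ε) :
    ∃ A ∈ compSpan p q, ‖A‖ ≤ 1 ∧ ‖A w - w‖ ≤ ε := by
  classical
  -- Domination and regularization cost `ε² / 4` each. For a contraction `A` this yields `‖A w - w‖²
  -- ≤ 2 (‖w‖² - re ⟪w, A w⟫) ≤ ε²`.
  have hδ : 0 < ε ^ 2 / 4 := by positivity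
  obtain ⟨n, s, hdom⟩ := (hq.normal w).exists_dominating (fun a => sq_nonneg _)
    (fun a b h => pow_le_pow_left₀ (norm_nonneg _) (hq.norm_apply_mono h w) 2)
    (fun (x : H) a => ‖p a x‖ ^ 2) hp.normal
    (fun x a b h => pow_le_pow_left₀ (norm_nonneg _) (hp.norm_apply_mono h x) 2) (by
      intro a b hab h
      have : p a = p b := by
        ext x
        have h1 := (hp.proj a).norm_sq_add (p b x)
        have h2 : p a (p b x) = p a x := DFunLike.congr_fun (hp.mul_of_le hab) x
        have h3 := h x
        rw [h2, h3] at h1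
        have h4 : ‖(1 - p a) (p b x)‖ = 0 := by
          have : ‖(1 - p a) (p b x)‖ ^ 2 = 0 := by linarith
          exact pow_eq_zero_iff (two_ne_zero) |>.mp this
        rw [norm_eq_zero, sub_apply, one_apply_eq_self, h2, sub_eq_zero] at h4
        exact h4.symm
      simp only [hsep a b this]) hδ
  let x : PiLp 2 (fun _ : s => H) := WithLp.toLp 2 fun i => (√n : ℂ) • (i : H)
  have hx : ∀ a, ‖diagOp s (p a) x‖ ^ 2 = n * ∑ i ∈ s, ‖p a i‖ ^ 2 := by
    intro a
    rw [PiLp.norm_sq_eq_of_L2, Finset.mul_sum, ← Finset.sum_attach s]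
    refine Finset.sum_congr rfl fun i _ => ?_
    change ‖p a ((√n : ℂ) • (i : H))‖ ^ 2 = _
    rw [map_smul, norm_smul, mul_pow, Complex.norm_real, Real.norm_of_nonneg (Real.sqrt_nonneg _),
      Real.sq_sqrt (Nat.cast_nonneg _)]
  obtain ⟨S, hS, T, hT, hnorm, hre⟩ := exists_intertwiners_of_dominated (x := x) (w := w)
    (hp.toIsLatticeRep.diagOp s) hq.toIsLatticeRep (ε := ε ^ 2 / 4) (by
      intro a b hab
      rw [hx, hx, ← mul_sub, ← Finset.sum_sub_distrib]
      exact hdom a b hab) (show 0 < ε ^ 2 / 4 / (‖x‖ ^ 2 + 1) by positivity)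
  refine ⟨T ∘L S, ?_, hnorm, ?_⟩
  · have hsum : T ∘L S = ∑ i : s, (T ∘L inclOp i) ∘L
        (PiLp.proj 2 (fun _ : s => H) i ∘L S) := by
      ext y
      rw [sum_apply]
      conv_lhs => rw [ContinuousLinearMap.comp_apply, ← sum_inclOp (S y), map_sum]
      rfl
    rw [hsum]
    refine Submodule.sum_mem _ fun i _ => Submodule.subset_span
      (⟨T ∘L inclOp i, ?_, PiLp.proj 2 (fun _ : s => H) i ∘L S, ?_, rfl⟩ :
        _ ∈ opMul (intertwiners p q : Set (H →L[ℂ] K)) (intertwiners q p : Set (K →L[ℂ] H)))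
    · refine mem_intertwiners.mpr fun a y => ?_
      rw [ContinuousLinearMap.comp_apply, ← diagOp_inclOp]
      exact mem_intertwiners.mp hT a _
    · refine mem_intertwiners.mpr fun a y => ?_
      exact congrArg (fun v : PiLp 2 (fun _ : s => H) => v i) (mem_intertwiners.mp hS a y)
  · have h1 : ‖(T ∘L S) w‖ ≤ ‖w‖ := by simpa using (T ∘L S).le_of_opNorm_le hnorm w
    have h2 : ε ^ 2 / 4 / (‖x‖ ^ 2 + 1) * ‖x‖ ^ 2 ≤ ε ^ 2 / 4 := by
      rw [div_mul_eq_mul_div, div_le_iff₀ (by positivity)]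
      nlinarith [sq_nonneg ‖x‖]
    have h3 := @norm_sub_sq ℂ K _ _ _ ((T ∘L S) w) w
    have h4 : (inner ℂ ((T ∘L S) w) w).re = (inner ℂ w (T (S w))).re := by
      rw [← inner_conj_symm]; exact Complex.conj_re _
    change ‖(T ∘L S) w - w‖ ^ 2 = ‖(T ∘L S) w‖ ^ 2 - 2 * (inner ℂ ((T ∘L S) w) w).re + ‖w‖ ^ 2 at h3
    rw [h4] at h3
    have h5 : ‖(T ∘L S) w‖ ^ 2 ≤ ‖w‖ ^ 2 := pow_le_pow_left₀ (norm_nonneg _) h1 2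
    refine le_of_sq_le_sq ?_ hε.le
    linarith

/-- An operator in the commutant of `q` preserves the range of every `q a`, so it can be absorbed
into the outer intertwiner on either side. -/
theorem comp_mem_compSpan {A B : K →L[ℂ] K} (hA : A ∈ compSpan p q)
    (hB : ∀ a, Commute B (q a)) : B ∘L A ∈ compSpan p q ∧ A ∘L B ∈ compSpan p q := by
  unfold compSpan at hA
  induction hA using Submodule.span_induction with
  | mem A hA =>
    obtain ⟨T, hT, S, hS, rfl⟩ := hA
    constructor
    · refine Submodule.subset_span ⟨B ∘L T, ?_, S, hS, rfl⟩
      refine mem_intertwiners.mpr fun a x => ?_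
      have h1 : B (q a (T (p a x))) = q a (B (T (p a x))) :=
        DFunLike.congr_fun (hB a).eq (T (p a x))
      have h2 := mem_intertwiners.mp hT a x
      simp only [sub_apply, one_apply_eq_self, ContinuousLinearMap.comp_apply] at h2 ⊢
      rw [← h1, ← map_sub, h2, map_zero]
    · refine Submodule.subset_span ⟨T, hT, S ∘L B, ?_, rfl⟩
      refine mem_intertwiners.mpr fun a x => ?_
      have h1 : B (q a x) = q a (B x) := DFunLike.congr_fun (hB a).eq x
      rw [ContinuousLinearMap.comp_apply, h1]
      exact mem_intertwiners.mp hS a (B x)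
  | zero => simp
  | add A A' _ _ h h' =>
    rw [ContinuousLinearMap.comp_add, ContinuousLinearMap.add_comp]
    exact ⟨add_mem h.1 h'.1, add_mem h.2 h'.2⟩
  | smul c A _ h =>
    rw [ContinuousLinearMap.comp_smul, ContinuousLinearMap.smul_comp]
    exact ⟨Submodule.smul_mem _ c h.1, Submodule.smul_mem _ c h.2⟩

open Filter Topology

/-- A set of vectors on which contractions from a space `M` of operators approximate the
identity. -/
def IsApproximable (M : Submodule ℂ (K →L[ℂ] K)) (Y : Set K) : Prop :=
  ∃ l : Filter (K →L[ℂ] K), l.NeBot ∧ (∀ᶠ A in l, A ∈ M ∧ ‖A‖ ≤ 1) ∧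
    ∀ y ∈ Y, Tendsto (fun A : K →L[ℂ] K => A y) l (𝓝 y)

namespace IsApproximable

variable {M : Submodule ℂ (K →L[ℂ] K)} {Y Z : Set K}

theorem mono (h : IsApproximable M Z) (hYZ : Y ⊆ Z) : IsApproximable M Y := by
  obtain ⟨l, h1, h2, h3⟩ := h
  exact ⟨l, h1, h2, fun y hy => h3 y (hYZ hy)⟩

/-- Convergence is linear in the vector, and the common norm bound carries it to closures. -/
theorem closure_span (h : IsApproximable M Y) :
    IsApproximable M ((Submodule.span ℂ Y).topologicalClosure : Set K) := by
  obtain ⟨l, h1, h2, h3⟩ := h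
  refine ⟨l, h1, h2, fun y hy => ?_⟩
  have hspan : ∀ z ∈ Submodule.span ℂ Y, Tendsto (fun A : K →L[ℂ] K => A z) l (𝓝 z) := by
    intro z hz
    induction hz using Submodule.span_induction with
    | mem z hz => exact h3 z hz
    | zero => simp
    | add u v _ _ hu hv => simpa using hu.add hv
    | smul c u _ hu => simpa using hu.const_smul c
  rw [Metric.tendsto_nhds]
  intro ε hε
  obtain ⟨z, hz, hyz⟩ := Metric.mem_closure_iff.mp hy (ε / 3) (by positivity)
  filter_upwards [h2, Metric.tendsto_nhds.mp (hspan z hz) (ε / 3) (by positivity)] with A hA hAz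
  have h4 : dist (A y) (A z) ≤ dist y z := by
    rw [dist_eq_norm, dist_eq_norm, ← map_sub]
    simpa using A.le_of_opNorm_le hA.2 (y - z)
  calc dist (A y) y ≤ dist (A y) (A z) + dist (A z) z + dist z y := dist_triangle4 _ _ _ _
    _ < ε := by rw [dist_comm z y]; linarith

theorem of_finite (h : ∀ F : Finset K, (F : Set K) ⊆ Y → IsApproximable M F) :
    IsApproximable M Y := by
  classical
  have hA : ∀ i : Finset Y × ℕ, ∃ A ∈ M, ‖A‖ ≤ 1 ∧ ∀ y ∈ i.1, dist (A y) y < 1 / ((i.2 : ℝ) + 1) := by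
    intro i
    obtain ⟨l, h1, h2, h3⟩ := h (i.1.image (↑)) (by simp)
    have h4 : ∀ᶠ A : K →L[ℂ] K in l, ∀ y ∈ i.1, dist (A y) y < 1 / ((i.2 : ℝ) + 1) := by
      rw [eventually_all_finset]
      intro y hy
      exact Metric.tendsto_nhds.mp (h3 y (by simpa using hy)) _ (by positivity)
    obtain ⟨A, hA, hA'⟩ := (h2.and h4).exists
    exact ⟨A, hA.1, hA.2, hA'⟩
  choose A hM hn hd using hA
  refine ⟨map A atTop, inferInstance, ?_, fun y hy => ?_⟩
  · rw [eventually_map]; exact Eventually.of_forall fun i => ⟨hM i, hn i⟩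
  · rw [tendsto_map'_iff, Metric.tendsto_nhds]
    intro ε hε
    obtain ⟨n, hn⟩ := exists_nat_one_div_lt hε
    filter_upwards [eventually_ge_atTop (({⟨y, hy⟩}, n) : Finset Y × ℕ)] with i hi
    refine (hd i ⟨y, hy⟩ (Finset.singleton_subset_iff.mp hi.1)).trans (lt_of_le_of_lt ?_ hn)
    have : (n : ℝ) ≤ i.2 := by exact_mod_cast hi.2
    gcongr

/-- Approximation can be checked on the two summands of a decomposition. -/
theorem of_split {E : K →L[ℂ] K} (hE : IsStarProjection E)
    (hM : ∀ A ∈ M, E ∘L A ∘L E ∈ M ∧ (1 - E) ∘L A ∘L (1 - E) ∈ M)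
    (h₁ : IsApproximable M (E '' Y)) (h₂ : IsApproximable M ((fun y => (1 - E) y) '' Y)) :
    IsApproximable M (Y ∪ E '' Y) := by
  obtain ⟨l₁, n₁, m₁, t₁⟩ := h₁
  obtain ⟨l₂, n₂, m₂, t₂⟩ := h₂
  have hEE : ∀ y, (1 - E) (E y) = 0 := fun y => by
    rw [sub_apply, one_apply_eq_self, hE.apply_apply, sub_self]
  have hEE' : ∀ y, E ((1 - E) y) = 0 := fun y => by
    rw [sub_apply, one_apply_eq_self, map_sub, hE.apply_apply, sub_self]
  -- A block diagonal operator with contractive blocks is again a contraction, so the norm bound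
  -- survives the gluing.
  let Φ : (K →L[ℂ] K) × (K →L[ℂ] K) → K →L[ℂ] K := fun A =>
    E ∘L A.1 ∘L E + (1 - E) ∘L A.2 ∘L (1 - E)
  have hΦ : ∀ A y, Φ A y = E (A.1 (E y)) + (1 - E) (A.2 ((1 - E) y)) := fun _ _ => rfl
  refine ⟨map Φ (l₁ ×ˢ l₂), inferInstance, ?_, ?_⟩
  · rw [eventually_map]
    filter_upwards [m₁.prod_mk m₂] with A hA
    refine ⟨add_mem (hM _ hA.1.1).1 (hM _ hA.2.1).2, ?_⟩
    refine ContinuousLinearMap.opNorm_le_bound _ zero_le_one fun y => ?_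
    rw [one_mul]
    refine le_of_sq_le_sq ?_ (norm_nonneg _)
    have e1 : E (Φ A y) = E (A.1 (E y)) := by
      rw [hΦ, map_add, hE.apply_apply, hEE', add_zero]
    have e2 : (1 - E) (Φ A y) = (1 - E) (A.2 ((1 - E) y)) := by
      rw [hΦ, map_add, hEE, hE.one_sub.apply_apply, zero_add]
    have b1 : ‖E (A.1 (E y))‖ ≤ ‖E y‖ := (hE.norm_apply_le _).trans (by
      simpa using A.1.le_of_opNorm_le hA.1.2 (E y))
    have b2 : ‖(1 - E) (A.2 ((1 - E) y))‖ ≤ ‖(1 - E) y‖ := (hE.one_sub.norm_apply_le _).trans (by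
      simpa using A.2.le_of_opNorm_le hA.2.2 ((1 - E) y))
    rw [hE.norm_sq_add (Φ A y), hE.norm_sq_add y, e1, e2]
    gcongr
  · have hfst : ∀ y ∈ Y, Tendsto (fun A : (K →L[ℂ] K) × (K →L[ℂ] K) => E (A.1 (E y)))
        (l₁ ×ˢ l₂) (𝓝 (E y)) := fun y hy => by
      have := (E.continuous.tendsto _).comp ((t₁ (E y) ⟨y, hy, rfl⟩).comp (tendsto_fst (f := l₁) (g := l₂)))
      rwa [hE.apply_apply] at this
    have hsnd : ∀ y ∈ Y, Tendsto (fun A : (K →L[ℂ] K) × (K →L[ℂ] K) =>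
        (1 - E) (A.2 ((1 - E) y))) (l₁ ×ˢ l₂) (𝓝 ((1 - E) y)) := fun y hy => by
      have := ((1 - E).continuous.tendsto _).comp
        ((t₂ ((1 - E) y) ⟨y, hy, rfl⟩).comp (tendsto_snd (f := l₁) (g := l₂)))
      rwa [hE.one_sub.apply_apply] at this
    rintro y (hy | ⟨y, hy, rfl⟩)
    · rw [tendsto_map'_iff]
      have := (hfst y hy).add (hsnd y hy)
      simpa [Function.comp_def, hΦ] using this
    · rw [tendsto_map'_iff]
      simpa [Function.comp_def, hΦ, hE.apply_apply, hEE] using hfst y hy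

end IsApproximable

theorem split_mem_compSpan {E : K →L[ℂ] K} (hE : ∀ a, Commute E (q a)) :
    ∀ A ∈ compSpan p q, E ∘L A ∘L E ∈ compSpan p q ∧ (1 - E) ∘L A ∘L (1 - E) ∈ compSpan p q := by
  have hE' : ∀ a, Commute (1 - E) (q a) := fun a => (Commute.one_left _).sub_left (hE a)
  exact fun A hA => ⟨(comp_mem_compSpan (comp_mem_compSpan hA hE).2 hE).1,
    (comp_mem_compSpan (comp_mem_compSpan hA hE').2 hE').1⟩

/-- Splitting along `q a` replaces `x` by `q a x` and `(1 - q a) x`, and each half needs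
approximation only for the remaining lattice elements. Induction on their number, for all `x` at
once, reduces to a single vector. -/
theorem isApproximable_cyclic (hp : IsNormalRep p) (hq : IsNormalRep q)
    (hsep : ∀ a b, p a = p b → q a = q b) (x : K) :
    IsApproximable (compSpan p q) (Set.range fun a => q a x) := by
  classical
  have key : ∀ (F : Finset Λ) (x : K),
      IsApproximable (compSpan p q) (insert x ((fun a => q a x) '' F)) := by
    intro F
    induction F using Finset.induction_on with
    | empty =>
      intro x
      refine IsApproximable.of_finite fun G hG => ?_
      have hA : ∀ n : ℕ, ∃ A ∈ compSpan p q, ‖A‖ ≤ 1 ∧ ‖A x - x‖ ≤ 1 / ((n : ℝ) + 1) :=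
        fun n => exists_compSpan_near hp hq hsep x (by positivity)
      choose A hM hn hd using hA
      refine ⟨map A atTop, inferInstance, ?_, fun y hy => ?_⟩
      · rw [eventually_map]; exact Eventually.of_forall fun i => ⟨hM i, hn i⟩
      · have hyx : y = x := by simpa using hG hy
        subst hyx
        rw [tendsto_map'_iff, tendsto_iff_norm_sub_tendsto_zero]
        exact squeeze_zero (fun _ => norm_nonneg _) hd tendsto_one_div_add_atTop_nhds_zero_nat
    | insert a F _ ih =>
      intro x
      have hcomm : ∀ b, Commute (q a) (q b) := hq.commute a
      have hcomm' : ∀ b, Commute (1 - q a) (q b) := fun b =>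
        (Commute.one_left _).sub_left (hcomm b)
      refine (IsApproximable.of_split (hq.proj a) (split_mem_compSpan hcomm)
        ((ih (q a x)).mono ?_) ((ih ((1 - q a) x)).mono ?_)).mono
        (Y := insert x ((fun a => q a x) '' ↑(insert a F)))
        (Z := insert x ((fun b => q b x) '' F) ∪ q a '' insert x ((fun b => q b x) '' F)) ?_
      · rintro _ ⟨y, rfl | ⟨b, hb, rfl⟩, rfl⟩
        · exact Or.inl rfl
        · exact Or.inr ⟨b, hb, (DFunLike.congr_fun (hcomm b).eq x).symm⟩
      · rintro _ ⟨y, rfl | ⟨b, hb, rfl⟩, rfl⟩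
        · exact Or.inl rfl
        · exact Or.inr ⟨b, hb, (DFunLike.congr_fun (hcomm' b).eq x).symm⟩
      · rintro y (rfl | ⟨b, hb, rfl⟩)
        · exact Or.inl (Or.inl rfl)
        · rcases Finset.mem_insert.mp hb with rfl | hb
          · exact Or.inr ⟨x, Or.inl rfl, rfl⟩
          · exact Or.inl (Or.inr ⟨b, hb, rfl⟩)
  refine IsApproximable.of_finite fun G hG => ?_
  obtain ⟨F, -, rfl⟩ := Finset.subset_set_image_iff.mp (Set.image_univ ▸ hG)
  refine (key F x).mono ?_
  rw [Finset.coe_image]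
  exact Set.subset_insert _ _

theorem commute_starProjection_of_invariant {N : Submodule ℂ K} [N.HasOrthogonalProjection]
    {e : K →L[ℂ] K} (he : IsStarProjection e) (h : ∀ y ∈ N, e y ∈ N) :
    Commute N.starProjection e := by
  have h1 : N.starProjection * (e * N.starProjection) = e * N.starProjection := by
    ext y
    exact Submodule.starProjection_eq_self_iff.mpr (h _ (N.starProjection_apply_mem y))
  have hN : star N.starProjection = N.starProjection :=
    (isStarProjection_starProjection (U := N)).isSelfAdjoint
  have h2 := congrArg star h1
  rw [star_mul, star_mul, he.isSelfAdjoint.star_eq, hN] at h2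
  rw [Commute, SemiconjBy, ← h2, mul_assoc, h1]

/-- Bounded approximate identities in the products of intertwiners. -/
theorem isApproximable_univ (hp : IsNormalRep p) (hq : IsNormalRep q)
    (hsep : ∀ a b, p a = p b → q a = q b) :
    IsApproximable (compSpan p q) Set.univ := by
  have key : ∀ (n : ℕ) (L : List K), L.length = n → IsApproximable (compSpan p q) {y | y ∈ L} := by
    intro n
    induction n with
    | zero =>
      intro L hL
      rw [List.length_eq_zero_iff.mp hL]
      exact (isApproximable_cyclic hp hq hsep 0).mono (by simp)
    | succ n ih =>
      intro L hL
      obtain ⟨x, L, rfl⟩ := List.exists_cons_of_length_eq_add_one hL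
      have hcyc := (isApproximable_cyclic hp hq hsep x).closure_span
      -- The cyclic subspace of `x` reduces `q`. Inside it the cyclic case applies; in its
      -- complement the component of `x` vanishes, leaving one vector fewer.
      set N := (Submodule.span ℂ (Set.range fun a => q a x)).topologicalClosure with hN
      have hinv : ∀ a, ∀ y ∈ N, q a y ∈ N := by
        intro a y hy
        refine map_mem_closure (q a).continuous hy fun z hz => ?_
        refine Submodule.span_induction (p := fun z _ => q a z ∈ Submodule.span ℂ _)
          ?_ ?_ ?_ ?_ hz
        · rintro _ ⟨b, rfl⟩
          refine Submodule.subset_span ⟨a ⊓ b, ?_⟩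
          exact DFunLike.congr_fun (hq.map_inf a b) x
        · rw [map_zero]; exact zero_mem _
        · intro u v _ _ hu hv
          rw [map_add]; exact add_mem hu hv
        · intro c u _ hu
          rw [map_smul]; exact Submodule.smul_mem _ c hu
      have : CompleteSpace N := (Submodule.isClosed_topologicalClosure _).completeSpace_coe
      have hxN : x ∈ N := Submodule.le_topologicalClosure _
        (Submodule.subset_span ⟨⊤, by simp [hq.map_top]⟩)
      have hx : N.starProjection x = x := Submodule.starProjection_eq_self_iff.mpr hxN
      have hrest := (ih (L.map fun y => (1 - N.starProjection) y) (by simpa using hL)).closure_span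
      refine (IsApproximable.of_split (Y := {y | y ∈ x :: L}) isStarProjection_starProjection
        (split_mem_compSpan fun a => commute_starProjection_of_invariant (hq.proj a) (hinv a))
        (hcyc.mono ?_) (hrest.mono ?_)).mono Set.subset_union_left
      · rintro _ ⟨y, -, rfl⟩
        exact N.starProjection_apply_mem y
      · rintro _ ⟨y, hy, rfl⟩
        rcases List.mem_cons.mp hy with rfl | hy
        · have : (1 - N.starProjection) y = 0 := by
            rw [sub_apply, one_apply_eq_self, hx, sub_self]
          beta_reduce
          rw [this]
          exact zero_mem _
        · exact Submodule.le_topologicalClosure _ (Submodule.subset_span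
            (List.mem_map.mpr ⟨y, hy, rfl⟩))
  refine IsApproximable.of_finite fun F _ => ?_
  exact (key _ F.toList rfl).mono fun y hy => Finset.mem_toList.mpr hy

end Approximation

/-! ### The lattice of projections and strong convergence -/

namespace Proj

open Filter Topology

variable {H : Type*} [NormedAddCommGroup H] [InnerProductSpace ℂ H] [CompleteSpace H]

theorem mem_ran_iff (P : Proj H) (x : H) : x ∈ P.ran ↔ P.op x = x := by
  refine ⟨?_, fun h => ⟨x, h⟩⟩
  rintro ⟨y, rfl⟩
  exact P.isStarProjection.apply_apply y

theorem op_injective : Function.Injective (op : Proj H → H →L[ℂ] H) := by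
  rintro ⟨p, hp⟩ ⟨q, hq⟩ rfl
  rfl

theorem le_iff_op {P Q : Proj H} : P ≤ Q ↔ Q.op * P.op = P.op := by
  rw [le_iff]
  constructor
  · intro h
    ext x
    exact (Q.mem_ran_iff _).mp (h ⟨x, rfl⟩)
  · intro h x hx
    rw [mem_ran_iff] at hx ⊢
    have := DFunLike.congr_fun h x
    change Q.op (P.op x) = P.op x at this
    rwa [hx] at this

/-- The complementary projection. -/
def compl (P : Proj H) : Proj H := ⟨1 - P.op, P.isStarProjection.one_sub⟩

theorem compl_compl (P : Proj H) : P.compl.compl = P :=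
  op_injective (sub_sub_cancel 1 P.op)

theorem compl_le_compl {P Q : Proj H} (h : P ≤ Q) : Q.compl ≤ P.compl := by
  rw [le_iff_op] at h ⊢
  have h2 := congrArg star h
  rw [star_mul, P.isStarProjection.isSelfAdjoint.star_eq,
    Q.isStarProjection.isSelfAdjoint.star_eq] at h2
  change (1 - P.op) * (1 - Q.op) = 1 - Q.op
  rw [mul_sub, sub_mul, sub_mul, h2]
  simp

/-- Taking complements reverses the order. -/
def complIso : Proj H ≃o (Proj H)ᵒᵈ where
  toFun P := OrderDual.toDual P.compl
  invFun P := (OrderDual.ofDual P).compl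
  left_inv P := P.compl_compl
  right_inv P := (OrderDual.ofDual P).compl_compl
  map_rel_iff' {P Q} := by
    refine ⟨fun h => ?_, fun h => compl_le_compl h⟩
    have := compl_le_compl (show Q.compl ≤ P.compl from h)
    rwa [compl_compl, compl_compl] at this

theorem gc_onto_ran : GaloisConnection (onto : Submodule ℂ H → Proj H) ran := onto_le_iff

theorem op_inf {P Q : Proj H} (h : Commute P.op Q.op) : (P ⊓ Q).op = P.op * Q.op := by
  have : P ⊓ Q = ⟨P.op * Q.op, P.isStarProjection.mul Q.isStarProjection h⟩ := by
    apply ran_injective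
    rw [gc_onto_ran.u_inf]
    ext x
    rw [Submodule.mem_inf, mem_ran_iff, mem_ran_iff, mem_ran_iff]
    change _ ↔ P.op (Q.op x) = x
    constructor
    · rintro ⟨h1, h2⟩
      rw [h2, h1]
    · intro hx
      have h3 : P.op (Q.op x) = Q.op (P.op x) := DFunLike.congr_fun h.eq x
      constructor
      · conv_lhs => rw [← hx]
        rw [P.isStarProjection.apply_apply, hx]
      · conv_lhs => rw [← hx, h3]
        rw [Q.isStarProjection.apply_apply, ← h3, hx]
  rw [this]

theorem compl_sup (P Q : Proj H) : (P ⊔ Q).compl = P.compl ⊓ Q.compl :=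
  complIso.map_sup P Q

theorem op_sup {P Q : Proj H} (h : Commute P.op Q.op) :
    (P ⊔ Q).op = P.op + Q.op - P.op * Q.op := by
  have h1 : (P ⊔ Q).compl.op = (1 - P.op) * (1 - Q.op) := by
    rw [compl_sup]
    exact op_inf (((Commute.one_left _).sub_left
      ((Commute.one_right _).sub_right h)))
  have h2 : (P ⊔ Q).op = 1 - (P ⊔ Q).compl.op := (sub_sub_cancel 1 _).symm
  rw [h2, h1]
  noncomm_ring

theorem op_top : (⊤ : Proj H).op = 1 := by
  ext x
  refine (mem_ran_iff _ x).mp ?_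
  rw [gc_onto_ran.u_top]
  trivial

theorem op_bot : (⊥ : Proj H).op = 0 := by
  have h : (⊥ : Proj H) ≤ ⟨0, .zero _⟩ := bot_le
  rw [le_iff_op] at h
  simpa using h.symm

/-- The union of the ranges is dense in the range of `Q = sSup D`. Choose `y` in it near `Q x`;
every later `R` fixes `y` and satisfies `R x = R (Q x)`, so `R x` stays near `Q x`. -/
theorem tendsto_op_sSup {D : Set (Proj H)} (hD : D.Nonempty) (hdir : DirectedOn (· ≤ ·) D)
    (x : H) : Tendsto (fun P : D => (P : Proj H).op x) atTop (𝓝 ((sSup D).op x)) := by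
  have : Nonempty D := hD.to_subtype
  set Q := sSup D with hQ
  have hmem : Q.op x ∈ closure (⋃ P ∈ D, (P.ran : Set H)) := by
    have hle : Q ≤ onto (⨆ P : D, (P : Proj H).ran) := sSup_le fun P hP => by
      rw [le_iff, ran_onto]
      exact (le_iSup (fun P : D => (P : Proj H).ran) ⟨P, hP⟩).trans
        (Submodule.le_topologicalClosure _)
    have h1 : Q.op x ∈ (onto (⨆ P : D, (P : Proj H).ran)).ran := hle ⟨x, rfl⟩
    rw [ran_onto] at h1
    have h2 : ((⨆ P : D, (P : Proj H).ran : Submodule ℂ H) : Set H) = ⋃ P ∈ D, (P.ran : Set H) := by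
      rw [Submodule.coe_iSup_of_directed _ (fun P P' => by
        obtain ⟨R, hR, h1, h2⟩ := hdir P P.2 P' P'.2
        exact ⟨⟨R, hR⟩, h1, h2⟩)]
      simp
    rw [← h2]
    exact h1
  rw [Metric.tendsto_nhds]
  intro ε hε
  obtain ⟨y, hy, hxy⟩ := Metric.mem_closure_iff.mp hmem (ε / 2) (by positivity)
  simp only [Set.mem_iUnion] at hy
  obtain ⟨P, hP, hy⟩ := hy
  filter_upwards [mem_atTop (⟨P, hP⟩ : D)] with R hR
  have hyR : (R : Proj H).op y = y := (mem_ran_iff _ _).mp (hR hy)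
  have hRQ : (R : Proj H).op (Q.op x) = (R : Proj H).op x := by
    have h1 := le_iff_op.mp (le_sSup R.2 : (R : Proj H) ≤ Q)
    have h2 := congrArg star h1
    rw [star_mul, (R : Proj H).isStarProjection.isSelfAdjoint.star_eq,
      Q.isStarProjection.isSelfAdjoint.star_eq] at h2
    exact DFunLike.congr_fun h2 x
  have h3 : ‖(R : Proj H).op (Q.op x - y)‖ ≤ ‖Q.op x - y‖ :=
    (R : Proj H).isStarProjection.norm_apply_le _
  rw [map_sub, hyR, hRQ] at h3
  rw [dist_eq_norm] at hxy ⊢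
  calc ‖(R : Proj H).op x - Q.op x‖ = ‖((R : Proj H).op x - y) - (Q.op x - y)‖ := by congr 1; abel
    _ ≤ ‖(R : Proj H).op x - y‖ + ‖Q.op x - y‖ := norm_sub_le _ _
    _ < ε := by linarith

theorem tendsto_op_sInf {D : Set (Proj H)} (hD : D.Nonempty) (hdir : DirectedOn (· ≥ ·) D)
    (x : H) : Tendsto (fun P : D => (P : Proj H).op x) atBot (𝓝 ((sInf D).op x)) := by
  have hdir' : DirectedOn (· ≤ ·) (compl '' D) := by
    rintro _ ⟨P, hP, rfl⟩ _ ⟨Q, hQ, rfl⟩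
    obtain ⟨R, hR, h1, h2⟩ := hdir P hP Q hQ
    exact ⟨R.compl, ⟨R, hR, rfl⟩, compl_le_compl h1, compl_le_compl h2⟩
  have h1 := tendsto_op_sSup (hD.image compl) hdir' x
  have h2 : sSup (compl '' D) = (sInf D).compl := by
    apply le_antisymm
    · refine sSup_le ?_
      rintro _ ⟨P, hP, rfl⟩
      exact compl_le_compl (sInf_le hP)
    · have h3 : (sSup (compl '' D)).compl ≤ sInf D := le_sInf fun P hP => by
        have := compl_le_compl (le_sSup ⟨P, hP, rfl⟩ : P.compl ≤ sSup (compl '' D))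
        rwa [compl_compl] at this
      have := compl_le_compl h3
      rwa [compl_compl] at this
  have hg : Tendsto (fun P : D => (⟨compl P, P, P.2, rfl⟩ : (compl '' D))) atBot atTop := by
    refine tendsto_atTop.mpr fun b => ?_
    obtain ⟨_, P, hP, rfl⟩ := b
    filter_upwards [mem_atBot (⟨P, hP⟩ : D)] with R hR
    exact compl_le_compl hR
  have h3 := (tendsto_const_nhds (x := x)).sub (h1.comp hg)
  have h4 : x - (sSup (compl '' D)).op x = (sInf D).op x := by
    rw [h2]; exact sub_sub_cancel x _
  rw [h4] at h3
  refine h3.congr fun P => ?_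
  exact sub_sub_cancel x _

theorem tendsto_iff {ι : Type*} {l : Filter ι} {f : ι → Proj H} {P : Proj H} :
    Tendsto f l (𝓝 P) ↔ ∀ x, Tendsto (fun i => (f i).op x) l (𝓝 (P.op x)) := by
  rw [nhds_induced, tendsto_comap_iff, tendsto_pi_nhds]
  rfl

/-- A sublattice of projections which is closed in the strong operator topology is complete. -/
def completeSublattice (L : Set (Proj H)) (hL : IsClosed L) (hbot : ⊥ ∈ L) (htop : ⊤ ∈ L)
    (hsup : SupClosed L) (hinf : InfClosed L) : CompleteSublattice (Proj H) where
  carrier := L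
  supClosed' := hsup
  infClosed' := hinf
  sSupClosed' s hs := by
    classical
    -- Finite joins form a directed set with the same supremum, which is therefore a strong limit of
    -- elements of `L`.
    let D : Set (Proj H) := {P | ∃ F : Finset (Proj H), (F : Set (Proj H)) ⊆ s ∧ P = F.sup id}
    have hDL : D ⊆ L := by
      rintro _ ⟨F, hF, rfl⟩
      exact Finset.sup_induction hbot (fun a ha b hb => hsup ha hb) fun P hP => hs (hF hP)
    have hDs : sSup D = sSup s := by
      apply le_antisymm
      · refine sSup_le ?_
        rintro _ ⟨F, hF, rfl⟩
        exact Finset.sup_le fun P hP => le_sSup (hF hP)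
      · exact sSup_le fun P hP => le_sSup ⟨{P}, by simpa using hP, by simp⟩
    have hne : D.Nonempty := ⟨⊥, ∅, by simp, by simp⟩
    have hdir : DirectedOn (· ≤ ·) D := by
      rintro _ ⟨F, hF, rfl⟩ _ ⟨G, hG, rfl⟩
      exact ⟨_, ⟨F ∪ G, by simp [hF, hG], rfl⟩, Finset.sup_mono Finset.subset_union_left,
        Finset.sup_mono Finset.subset_union_right⟩
    have := atTop_neBot_of_directedOn hne hdir
    rw [← hDs]
    exact hL.mem_of_tendsto (tendsto_iff.mpr (tendsto_op_sSup hne hdir))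
      (Eventually.of_forall fun P => hDL P.2)
  sInfClosed' s hs := by
    classical
    let D : Set (Proj H) := {P | ∃ F : Finset (Proj H), (F : Set (Proj H)) ⊆ s ∧ P = F.inf id}
    have hDL : D ⊆ L := by
      rintro _ ⟨F, hF, rfl⟩
      exact Finset.inf_induction htop (fun a ha b hb => hinf ha hb) fun P hP => hs (hF hP)
    have hDs : sInf D = sInf s := by
      apply le_antisymm
      · exact le_sInf fun P hP => sInf_le ⟨{P}, by simpa using hP, by simp⟩
      · refine le_sInf ?_
        rintro _ ⟨F, hF, rfl⟩
        exact Finset.le_inf fun P hP => sInf_le (hF hP)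
    have hne : D.Nonempty := ⟨⊤, ∅, by simp, by simp⟩
    have hdir : DirectedOn (· ≥ ·) D := by
      rintro _ ⟨F, hF, rfl⟩ _ ⟨G, hG, rfl⟩
      exact ⟨_, ⟨F ∪ G, by simp [hF, hG], rfl⟩, Finset.inf_mono Finset.subset_union_left,
        Finset.inf_mono Finset.subset_union_right⟩
    have := atBot_neBot_of_directedOn hne hdir
    rw [← hDs]
    exact hL.mem_of_tendsto (tendsto_iff.mpr (tendsto_op_sInf hne hdir))
      (Eventually.of_forall fun P => hDL P.2)

theorem isNormalRep {Λ : Type*} [CompleteLattice Λ] (f : CompleteLatticeHom Λ (Proj H))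
    (hcomm : ∀ a b, Commute (f a).op (f b).op) : IsNormalRep fun a => (f a).op where
  proj a := (f a).isStarProjection
  map_inf a b := by rw [map_inf f a b, op_inf (hcomm a b)]
  map_sup a b := by rw [map_sup f a b, op_sup (hcomm a b)]
  map_top := by rw [TopHomClass.map_top f, op_top]
  map_bot := by rw [BotHomClass.map_bot f, op_bot]
  normal x := by
    refine ⟨fun a b => ?_, fun D hD h => ?_, fun D hD h => ?_⟩
    · have key : ∀ P : Proj H, ((‖P.op x‖ ^ 2 : ℝ) : ℂ) = inner ℂ (P.op x) x := fun P =>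
        (P.isStarProjection.inner_self x).symm
      have : ((‖(f (a ⊔ b)).op x‖ ^ 2 + ‖(f (a ⊓ b)).op x‖ ^ 2 : ℝ) : ℂ) =
          ((‖(f a).op x‖ ^ 2 + ‖(f b).op x‖ ^ 2 : ℝ) : ℂ) := by
        rw [Complex.ofReal_add, Complex.ofReal_add, key, key, key, key, map_sup f a b,
          map_inf f a b, op_sup (hcomm a b), op_inf (hcomm a b), ← inner_add_left,
          ← inner_add_left]
        simp
      exact_mod_cast this
    · have hdir : DirectedOn (· ≤ ·) (f '' D) := by
        rintro _ ⟨a, ha, rfl⟩ _ ⟨b, hb, rfl⟩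
        obtain ⟨c, hc, h1, h2⟩ := h a ha b hb
        exact ⟨f c, ⟨c, hc, rfl⟩, OrderHomClass.mono f h1, OrderHomClass.mono f h2⟩
      have h1 := tendsto_op_sSup (hD.image f) hdir x
      rw [← map_sSup f] at h1
      have hg : Tendsto (fun d : D => (⟨f d, d, d.2, rfl⟩ : (f '' D))) atTop atTop := by
        refine Monotone.tendsto_atTop_atTop (fun a b hab => OrderHomClass.mono f hab) ?_
        rintro ⟨_, a, ha, rfl⟩
        exact ⟨⟨a, ha⟩, le_rfl⟩
      exact ((h1.comp hg).norm).pow 2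
    · have hdir : DirectedOn (· ≥ ·) (f '' D) := by
        rintro _ ⟨a, ha, rfl⟩ _ ⟨b, hb, rfl⟩
        obtain ⟨c, hc, h1, h2⟩ := h a ha b hb
        exact ⟨f c, ⟨c, hc, rfl⟩, OrderHomClass.mono f h1, OrderHomClass.mono f h2⟩
      have h1 := tendsto_op_sInf (hD.image f) hdir x
      rw [← map_sInf f] at h1
      have hg : Tendsto (fun d : D => (⟨f d, d, d.2, rfl⟩ : (f '' D))) atBot atBot := by
        refine Monotone.tendsto_atBot_atBot (fun a b hab => OrderHomClass.mono f hab) ?_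
        rintro ⟨_, a, ha, rfl⟩
        exact ⟨⟨a, ha⟩, le_rfl⟩
      exact ((h1.comp hg).norm).pow 2

end Proj

/-! ### Weak* closures of spans -/

section WeakStar

open Filter Topology

variable {H K : Type*}
  [NormedAddCommGroup H] [InnerProductSpace ℂ H] [CompleteSpace H]
  [NormedAddCommGroup K] [InnerProductSpace ℂ K] [CompleteSpace K]

/-- On bounded sets strong convergence implies weak* convergence: the series defining each
functional is dominated by a multiple of `‖x n‖² + ‖y n‖²`. -/
theorem mem_wkSpan_of_tendsto {ι : Type*} {l : Filter ι} [l.NeBot] {𝒳 : Set (H →L[ℂ] K)}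
    {f : ι → H →L[ℂ] K} {T : H →L[ℂ] K} {C : ℝ} (hC : ∀ᶠ i in l, ‖f i‖ ≤ C)
    (hmem : ∀ᶠ i in l, f i ∈ Submodule.span ℂ 𝒳)
    (hlim : ∀ x, Tendsto (fun i => f i x) l (𝓝 (T x))) : T ∈ wkSpan 𝒳 := by
  refine @mem_closure_of_tendsto _ (weakStarTopology H K) _ _ _ _ _ _ ?_ hmem
  rw [nhds_induced, tendsto_comap_iff, tendsto_pi_nhds]
  rintro ⟨⟨x, y⟩, hx, hy⟩
  refine tendsto_tsum_of_dominated_convergence (bound := fun n => |C| * (‖x n‖ ^ 2 + ‖y n‖ ^ 2))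
    ((hx.add hy).mul_left _) (fun n => tendsto_const_nhds.inner (hlim (x n))) ?_
  filter_upwards [hC] with i hi n
  have h1 : ‖f i (x n)‖ ≤ |C| * ‖x n‖ := (f i).le_of_opNorm_le (hi.trans (le_abs_self C)) _
  calc ‖inner ℂ (y n) (f i (x n))‖ ≤ ‖y n‖ * ‖f i (x n)‖ := norm_inner_le_norm _ _
    _ ≤ ‖y n‖ * (|C| * ‖x n‖) := by gcongr
    _ = |C| * (‖x n‖ * ‖y n‖) := by ring
    _ ≤ |C| * (‖x n‖ ^ 2 + ‖y n‖ ^ 2) := by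
      gcongr
      nlinarith [sq_nonneg (‖x n‖ - ‖y n‖), sq_nonneg ‖x n‖, sq_nonneg ‖y n‖]

theorem continuous_weakStar_inner (x : H) (y : K) :
    @Continuous _ _ (weakStarTopology H K) _ fun T : H →L[ℂ] K => inner ℂ y (T x) := by
  let P : {p : (ℕ → H) × (ℕ → K) //
      Summable (fun n => ‖p.1 n‖ ^ 2) ∧ Summable (fun n => ‖p.2 n‖ ^ 2)} :=
    ⟨(Pi.single 0 x, Pi.single 0 y),
      summable_of_ne_finset_zero (s := {0}) fun n hn => by
        simp [Finset.mem_singleton.not.mp hn],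
      summable_of_ne_finset_zero (s := {0}) fun n hn => by
        simp [Finset.mem_singleton.not.mp hn]⟩
  have h1 : (fun T : H →L[ℂ] K => inner ℂ y (T x)) =
      (fun g => g P) ∘ fun (T : H →L[ℂ] K) (p : {p : (ℕ → H) × (ℕ → K) //
        Summable (fun n => ‖p.1 n‖ ^ 2) ∧ Summable (fun n => ‖p.2 n‖ ^ 2)}) =>
      ∑' n, inner ℂ (p.1.2 n) (T (p.1.1 n)) := by
    ext T
    change _ = ∑' n, inner ℂ ((Pi.single 0 y : ℕ → K) n) (T ((Pi.single 0 x : ℕ → H) n))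
    rw [tsum_eq_single 0 (fun n hn => by simp [hn])]
    simp
  rw [h1]
  exact @Continuous.comp _ _ _ (weakStarTopology H K) _ _ _ _ (continuous_apply P)
    continuous_induced_dom

/-- The vanishing of a corner amounts to the vanishing of vector functionals, which are linear and
weak* continuous. -/
theorem corner_eq_zero_of_mem_wkSpan {H' K' : Type*}
    [NormedAddCommGroup H'] [InnerProductSpace ℂ H'] [CompleteSpace H']
    [NormedAddCommGroup K'] [InnerProductSpace ℂ K'] [CompleteSpace K']
    {𝒳 : Set (H →L[ℂ] K)} (A : K →L[ℂ] K') (B : H' →L[ℂ] H)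
    (h : ∀ T ∈ 𝒳, A ∘L T ∘L B = 0) {T : H →L[ℂ] K} (hT : T ∈ wkSpan 𝒳) : A ∘L T ∘L B = 0 := by
  ext z
  refine ext_inner_left ℂ fun y => ?_
  have hcl : @IsClosed _ (weakStarTopology H K)
      {T : H →L[ℂ] K | inner ℂ (ContinuousLinearMap.adjoint A y) (T (B z)) = 0} :=
    @IsClosed.preimage _ _ (weakStarTopology H K) _ _ (continuous_weakStar_inner _ _) _
      (isClosed_singleton (x := (0 : ℂ)))
  have hsub : (Submodule.span ℂ 𝒳 : Set (H →L[ℂ] K)) ⊆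
      {T : H →L[ℂ] K | inner ℂ (ContinuousLinearMap.adjoint A y) (T (B z)) = 0} := by
    intro S hS
    change inner ℂ (ContinuousLinearMap.adjoint A y) (S (B z)) = 0
    rw [ContinuousLinearMap.adjoint_inner_left]
    have hS0 : A ∘L S ∘L B = 0 := by
      induction hS using Submodule.span_induction with
      | mem S hS => exact h S hS
      | zero => simp
      | add S S' _ _ h1 h2 =>
        rw [ContinuousLinearMap.add_comp, ContinuousLinearMap.comp_add, h1, h2, add_zero]
      | smul c S _ h1 =>
        rw [ContinuousLinearMap.smul_comp, ContinuousLinearMap.comp_smul, h1, smul_zero]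
    have : A (S (B z)) = 0 := DFunLike.congr_fun hS0 z
    rw [this, inner_zero_right]
  have hmem := @closure_minimal _ (weakStarTopology H K) _ _ hsub hcl T hT
  change inner ℂ (ContinuousLinearMap.adjoint A y) (T (B z)) = 0 at hmem
  rw [ContinuousLinearMap.adjoint_inner_left] at hmem
  rw [zero_apply, inner_zero_right]
  exact hmem

theorem mem_Alg_iff {𝓛 : Set (Proj H)} {T : H →L[ℂ] H} :
    T ∈ Alg 𝓛 ↔ ∀ L ∈ 𝓛, L.perp ∘L T ∘L L.op = 0 := by
  refine forall₂_congr fun L _ => ?_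
  constructor
  · intro h
    ext x
    change T (L.op x) - L.op (T (L.op x)) = 0
    have h1 : L.op (T (L.op x)) = T (L.op x) := (L.mem_ran_iff _).mp (h _ ⟨x, rfl⟩)
    rw [h1, sub_self]
  · intro h x hx
    have h1 : T (L.op x) - L.op (T (L.op x)) = 0 := DFunLike.congr_fun h x
    rw [(L.mem_ran_iff x).mp hx, sub_eq_zero] at h1
    exact (L.mem_ran_iff _).mpr h1.symm

theorem mem_opAdj_Alg_iff {𝓛 : Set (Proj H)} {T : H →L[ℂ] H} :
    T ∈ opAdj (Alg 𝓛) ↔ ∀ L ∈ 𝓛, L.op ∘L T ∘L L.perp = 0 := by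
  have key : ∀ (L : Proj H) (A : H →L[ℂ] H),
      ContinuousLinearMap.adjoint (L.perp ∘L A ∘L L.op) =
        L.op ∘L ContinuousLinearMap.adjoint A ∘L L.perp := by
    intro L A
    rw [ContinuousLinearMap.adjoint_comp, ContinuousLinearMap.adjoint_comp]
    have h1 : ContinuousLinearMap.adjoint L.op = L.op := L.isStarProjection.isSelfAdjoint
    have h2 : ContinuousLinearMap.adjoint L.perp = L.perp :=
      L.isStarProjection.one_sub.isSelfAdjoint
    rw [h1, h2]
    rfl
  constructor
  · rintro ⟨A, hA, rfl⟩ L hL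
    rw [← key, mem_Alg_iff.mp hA L hL, map_zero]
  · intro h
    refine ⟨ContinuousLinearMap.adjoint T, mem_Alg_iff.mpr fun L hL => ?_,
      ContinuousLinearMap.adjoint_adjoint T⟩
    apply (ContinuousLinearMap.adjoint (𝕜 := ℂ) (E := H) (F := H)).injective
    rw [key, ContinuousLinearMap.adjoint_adjoint, h L hL, map_zero]

end WeakStar

/-! ### Approximate identities for lattice homomorphisms -/

section Approximation

open Filter Topology

variable {H K : Type*}
  [NormedAddCommGroup H] [InnerProductSpace ℂ H] [CompleteSpace H]
  [NormedAddCommGroup K] [InnerProductSpace ℂ K] [CompleteSpace K]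

/-- The lattice `L₁` indexes both representations: `p` is the inclusion, which is injective and so
separates points, and `q` is `θ`. Its strong closedness makes it a complete sublattice. The second
half is the first for the opposite lattice and the complementary projections. -/
theorem isApproximable_of_isCSLHom {L₁ : Set (Proj H)} {L₂ : Set (Proj K)} (hcl : IsClosed L₁)
    (hbot : ⊥ ∈ L₁) (htop : ⊤ ∈ L₁) (hsup : SupClosed L₁) (hinf : InfClosed L₁)
    (hc₁ : ∀ P ∈ L₁, ∀ P' ∈ L₁, Commute P.op P'.op)
    (hc₂ : ∀ P ∈ L₂, ∀ P' ∈ L₂, Commute P.op P'.op) {θ : L₁ → L₂} (hθ : IsCSLHom θ) :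
    IsApproximable (Submodule.span ℂ (opMul
      {T : H →L[ℂ] K | ∀ P : L₁, (θ P : Proj K).perp ∘L T ∘L (P : Proj H).op = 0}
      {T : K →L[ℂ] H | ∀ P : L₁, (P : Proj H).perp ∘L T ∘L (θ P : Proj K).op = 0})) Set.univ ∧
    IsApproximable (Submodule.span ℂ (opMul
      {T : H →L[ℂ] K | ∀ P : L₁, (θ P : Proj K).op ∘L T ∘L (P : Proj H).perp = 0}
      {T : K →L[ℂ] H | ∀ P : L₁, (P : Proj H).op ∘L T ∘L (θ P : Proj K).perp = 0})) Set.univ := by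
  let C := Proj.completeSublattice L₁ hcl hbot htop hsup hinf
  let f : CompleteLatticeHom C (Proj H) := CompleteSublattice.subtype C
  let g : CompleteLatticeHom C (Proj K) :=
    { toFun := fun P => (θ P : Proj K)
      map_sSup' := fun A => hθ.map_sSup A (sSup (α := C) A) (map_sSup f A)
      map_sInf' := fun A => hθ.map_sInf A (sInf (α := C) A) (map_sInf f A) }
  have hp := Proj.isNormalRep f fun a b => hc₁ a a.2 b b.2
  have hq := Proj.isNormalRep g fun a b => hc₂ _ (θ a).2 _ (θ b).2
  have hsep : ∀ a b : C, (f a).op = (f b).op → a = b := fun a b h =>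
    Subtype.ext (Proj.op_injective h)
  refine ⟨isApproximable_univ (Λ := C) hp hq fun a b h => by rw [hsep a b h], ?_⟩
  have h := isApproximable_univ hp.dual hq.dual fun a b h => by
    rw [hsep (OrderDual.ofDual a) (OrderDual.ofDual b) (sub_right_injective h)]
  have h1 : ((intertwiners (fun a : Cᵒᵈ => 1 - (f (OrderDual.ofDual a)).op)
      fun a => 1 - (g (OrderDual.ofDual a)).op : Submodule ℂ (H →L[ℂ] K)) : Set (H →L[ℂ] K)) =
      {T : H →L[ℂ] K | ∀ P : L₁, (θ P : Proj K).op ∘L T ∘L (P : Proj H).perp = 0} := by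
    ext T
    refine forall_congr' fun a => ?_
    rw [sub_sub_cancel]
    rfl
  have h2 : ((intertwiners (fun a : Cᵒᵈ => 1 - (g (OrderDual.ofDual a)).op)
      fun a => 1 - (f (OrderDual.ofDual a)).op : Submodule ℂ (K →L[ℂ] H)) : Set (K →L[ℂ] H)) =
      {T : K →L[ℂ] H | ∀ P : L₁, (P : Proj H).op ∘L T ∘L (θ P : Proj K).perp = 0} := by
    ext T
    refine forall_congr' fun a => ?_
    rw [sub_sub_cancel]
    rfl
  rwa [compSpan, h1, h2] at h

theorem IsApproximable.mem_wkSpan {M : Submodule ℂ (K →L[ℂ] K)} (h : IsApproximable M Set.univ)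
    {𝒳 : Set (H →L[ℂ] K)} {T : H →L[ℂ] K}
    (hM : ∀ A ∈ M, A ∘L T ∈ Submodule.span ℂ 𝒳) : T ∈ wkSpan 𝒳 := by
  obtain ⟨l, _, hl, hlim⟩ := h
  refine mem_wkSpan_of_tendsto (f := fun A => A ∘L T) (l := l) (C := ‖T‖) ?_
    (hl.mono fun A hA => hM A hA.1) fun x => hlim _ trivial
  filter_upwards [hl] with A hA
  calc ‖A ∘L T‖ ≤ ‖A‖ * ‖T‖ := A.opNorm_comp_le T
    _ ≤ 1 * ‖T‖ := by gcongr; exact hA.2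
    _ = ‖T‖ := one_mul _

theorem IsApproximable.mem_wkSpan_comp {M : Submodule ℂ (K →L[ℂ] K)} {N : Submodule ℂ (H →L[ℂ] H)}
    (hM : IsApproximable M Set.univ) (hN : IsApproximable N Set.univ)
    {𝒳 : Set (H →L[ℂ] K)} {T : H →L[ℂ] K}
    (h : ∀ A ∈ M, ∀ B ∈ N, A ∘L T ∘L B ∈ Submodule.span ℂ 𝒳) : T ∈ wkSpan 𝒳 := by
  obtain ⟨l, _, hl, hlim⟩ := hM
  obtain ⟨m, _, hm, hlim'⟩ := hN
  refine mem_wkSpan_of_tendsto (f := fun A => A.1 ∘L T ∘L A.2) (l := l ×ˢ m) (C := ‖T‖) ?_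
    ((hl.prod_mk hm).mono fun A hA => h _ hA.1.1 _ hA.2.1) fun x => ?_
  · filter_upwards [hl.prod_mk hm] with A hA
    calc ‖A.1 ∘L T ∘L A.2‖ ≤ ‖A.1‖ * ‖T ∘L A.2‖ := A.1.opNorm_comp_le _
      _ ≤ ‖A.1‖ * (‖T‖ * ‖A.2‖) := by gcongr; exact T.opNorm_comp_le _
      _ ≤ 1 * (‖T‖ * 1) := by gcongr; exacts [hA.1.2, hA.2.2]
      _ = ‖T‖ := by ring
  -- Products converge strongly because the left factors are contractions: `A T B x = A (T B x - T
  -- x) + A T x`.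
  · have h1 : Tendsto (fun A : (K →L[ℂ] K) × (H →L[ℂ] H) => T (A.2 x) - T x) (l ×ˢ m) (𝓝 0) := by
      have := (T.continuous.tendsto x).comp ((hlim' x trivial).comp (tendsto_snd (f := l)))
      simpa using this.sub_const (T x)
    have h2 : Tendsto (fun A : (K →L[ℂ] K) × (H →L[ℂ] H) => A.1 (T (A.2 x) - T x)) (l ×ˢ m)
        (𝓝 0) := by
      refine squeeze_zero_norm' ?_ (tendsto_zero_iff_norm_tendsto_zero.mp h1)
      filter_upwards [hl.prod_mk hm] with A hA
      simpa using A.1.le_of_opNorm_le hA.1.2 (T (A.2 x) - T x)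
    have h3 := h2.add ((hlim (T x) trivial).comp (tendsto_fst (g := m)))
    rw [zero_add] at h3
    refine h3.congr fun A => ?_
    simp

end Approximation

section Span

variable {H K H₁ : Type*} [NormedAddCommGroup H] [InnerProductSpace ℂ H]
  [NormedAddCommGroup K] [InnerProductSpace ℂ K] [NormedAddCommGroup H₁] [InnerProductSpace ℂ H₁]

theorem comp_mem_span_opMul
    {V : Set (H₁ →L[ℂ] K)} {W : Set (K →L[ℂ] H₁)} {T : H →L[ℂ] K} {𝒳 : Set (H →L[ℂ] K)}
    (h : ∀ X ∈ V, ∀ Y ∈ W, X ∘L Y ∘L T ∈ Submodule.span ℂ 𝒳) {A : K →L[ℂ] K}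
    (hA : A ∈ Submodule.span ℂ (opMul V W)) : A ∘L T ∈ Submodule.span ℂ 𝒳 := by
  induction hA using Submodule.span_induction with
  | mem A hA =>
    obtain ⟨X, hX, Y, hY, rfl⟩ := hA
    exact h X hX Y hY
  | zero => simp
  | add A B _ _ h1 h2 =>
    rw [ContinuousLinearMap.add_comp]
    exact add_mem h1 h2
  | smul c A _ h1 =>
    rw [ContinuousLinearMap.smul_comp]
    exact Submodule.smul_mem _ c h1

theorem comp_mem_span_opMul'
    {V : Set (H₁ →L[ℂ] H)} {W : Set (H →L[ℂ] H₁)} {T : H →L[ℂ] K} {𝒳 : Set (H →L[ℂ] K)}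
    (h : ∀ X ∈ V, ∀ Y ∈ W, T ∘L X ∘L Y ∈ Submodule.span ℂ 𝒳) {A : H →L[ℂ] H}
    (hA : A ∈ Submodule.span ℂ (opMul V W)) : T ∘L A ∈ Submodule.span ℂ 𝒳 := by
  induction hA using Submodule.span_induction with
  | mem A hA =>
    obtain ⟨X, hX, Y, hY, rfl⟩ := hA
    exact h X hX Y hY
  | zero => simp
  | add A B _ _ h1 h2 =>
    rw [ContinuousLinearMap.comp_add]
    exact add_mem h1 h2
  | smul c A _ h1 =>
    rw [ContinuousLinearMap.comp_smul]
    exact Submodule.smul_mem _ c h1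

end Span

section Products

variable {H K K' : Type*}
  [NormedAddCommGroup H] [InnerProductSpace ℂ H]
  [NormedAddCommGroup K] [InnerProductSpace ℂ K] [CompleteSpace K]
  [NormedAddCommGroup K'] [InnerProductSpace ℂ K']

/-- The second equation says `T B = P T B`, and `A S P = 0` kills the result. -/
theorem Proj.corner_comp_eq_zero (P : Proj K) {A : K' →L[ℂ] K'} {S : K →L[ℂ] K'}
    {T : H →L[ℂ] K} {B : H →L[ℂ] H} (hS : A ∘L S ∘L P.op = 0)
    (hT : P.perp ∘L T ∘L B = 0) : A ∘L (S ∘L T) ∘L B = 0 := by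
  ext x
  have h1 : A (S (P.op (T (B x)))) = 0 := DFunLike.congr_fun hS (T (B x))
  have h2 : T (B x) - P.op (T (B x)) = 0 := DFunLike.congr_fun hT x
  rw [← sub_eq_zero.mp h2] at h1
  exact h1

theorem Proj.corner_comp_eq_zero' (P : Proj K) {A : K' →L[ℂ] K'} {S : K →L[ℂ] K'}
    {T : H →L[ℂ] K} {B : H →L[ℂ] H} (hS : A ∘L S ∘L P.perp = 0)
    (hT : P.op ∘L T ∘L B = 0) : A ∘L (S ∘L T) ∘L B = 0 := by
  refine P.compl.corner_comp_eq_zero hS ?_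
  rwa [show P.compl.perp = P.op from sub_sub_cancel 1 P.op]

end Products

namespace IsStronglyClosedCommBilattice

variable {H₁ H₂ : Type*}
  [NormedAddCommGroup H₁] [InnerProductSpace ℂ H₁] [CompleteSpace H₁]
  [NormedAddCommGroup H₂] [InnerProductSpace ℂ H₂] [CompleteSpace H₂]
  {S : Set (Proj H₁ × Proj H₂)}

/-- Combining a pair with `(0, 0)` erases its second entry. Hence the left set is a slice of `S`,
which makes it strongly closed. -/
theorem mem_leftSet_iff (hS : IsStronglyClosedCommBilattice S) {P : Proj H₁} :
    P ∈ leftSet S ↔ (P, ⊥) ∈ S := by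
  refine ⟨fun ⟨Q, h⟩ => ?_, fun h => ⟨_, h⟩⟩
  simpa using hS.sup_inf_mem _ h _ hS.bot_bot_mem

theorem mem_rightSet_iff (hS : IsStronglyClosedCommBilattice S) {Q : Proj H₂} :
    Q ∈ rightSet S ↔ (⊥, Q) ∈ S := by
  refine ⟨fun ⟨P, h⟩ => ?_, fun h => ⟨_, h⟩⟩
  simpa using hS.inf_sup_mem _ h _ hS.bot_bot_mem

theorem isClosed_leftSet (hS : IsStronglyClosedCommBilattice S) : IsClosed (leftSet S) := by
  have h : leftSet S = (fun P => (P, ⊥)) ⁻¹' S := Set.ext fun _ => hS.mem_leftSet_iff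
  rw [h]
  exact hS.isClosed.preimage (by fun_prop)

theorem isClosed_rightSet (hS : IsStronglyClosedCommBilattice S) : IsClosed (rightSet S) := by
  have h : rightSet S = (fun Q => (⊥, Q)) ⁻¹' S := Set.ext fun _ => hS.mem_rightSet_iff
  rw [h]
  exact hS.isClosed.preimage (by fun_prop)

theorem supClosed_leftSet (hS : IsStronglyClosedCommBilattice S) : SupClosed (leftSet S) := by
  rintro P ⟨Q, h⟩ P' ⟨Q', h'⟩
  have h'' := hS.sup_inf_mem _ h _ h'
  exact ⟨_, h''⟩

theorem infClosed_leftSet (hS : IsStronglyClosedCommBilattice S) : InfClosed (leftSet S) := by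
  rintro P ⟨Q, h⟩ P' ⟨Q', h'⟩
  have h'' := hS.inf_sup_mem _ h _ h'
  exact ⟨_, h''⟩

theorem supClosed_rightSet (hS : IsStronglyClosedCommBilattice S) : SupClosed (rightSet S) := by
  rintro P ⟨Q, h⟩ P' ⟨Q', h'⟩
  have h'' := hS.inf_sup_mem _ h _ h'
  exact ⟨_, h''⟩

theorem infClosed_rightSet (hS : IsStronglyClosedCommBilattice S) : InfClosed (rightSet S) := by
  rintro P ⟨Q, h⟩ P' ⟨Q', h'⟩
  have h'' := hS.sup_inf_mem _ h _ h'
  exact ⟨_, h''⟩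

end IsStronglyClosedCommBilattice

/-! ### Bimodule inclusions and the theorem -/

section Bimodules

variable {H₁ H₂ K₁ K₂ : Type*}
  [NormedAddCommGroup H₁] [InnerProductSpace ℂ H₁] [CompleteSpace H₁]
  [NormedAddCommGroup H₂] [InnerProductSpace ℂ H₂] [CompleteSpace H₂]
  [NormedAddCommGroup K₁] [InnerProductSpace ℂ K₁] [CompleteSpace K₁]
  [NormedAddCommGroup K₂] [InnerProductSpace ℂ K₂] [CompleteSpace K₂]
  {S₁ : Set (Proj H₁ × Proj H₂)} {S₂ : Set (Proj K₁ × Proj K₂)}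
  {φ : leftSet S₁ → leftSet S₂} {ψ : rightSet S₁ → rightSet S₂}

theorem comp_mem_bilatticeSpace_left (hom : IsBilatticeHom φ ψ) {X : K₂ →L[ℂ] H₂}
    (hX : X ∈ spaceW₂ ψ) {T : K₁ →L[ℂ] K₂} (hT : T ∈ bilatticeSpace S₂) {Y : H₁ →L[ℂ] K₁}
    (hY : Y ∈ spaceV₁ φ) : X ∘L T ∘L Y ∈ bilatticeSpace S₁ := by
  rintro ⟨P, Q⟩ hPQ
  let P' : leftSet S₁ := ⟨P, Q, hPQ⟩
  let Q' : rightSet S₁ := ⟨Q, P, hPQ⟩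
  exact (ψ Q' : Proj K₂).corner_comp_eq_zero' (hX Q')
    ((φ P' : Proj K₁).corner_comp_eq_zero (hT _ (hom.map_mem P' Q' hPQ)) (hY P'))

theorem comp_mem_bilatticeSpace_right (honto : IsOntoBilattice φ ψ) {X : H₂ →L[ℂ] K₂}
    (hX : X ∈ spaceV₂ ψ) {T : H₁ →L[ℂ] H₂} (hT : T ∈ bilatticeSpace S₁) {Y : K₁ →L[ℂ] H₁}
    (hY : Y ∈ spaceW₁ φ) : X ∘L T ∘L Y ∈ bilatticeSpace S₂ := by
  rintro ⟨P, Q⟩ hPQ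
  obtain ⟨P', Q', h, rfl, rfl⟩ := honto _ hPQ
  exact (Q' : Proj H₂).corner_comp_eq_zero' (hX Q')
    ((P' : Proj H₁).corner_comp_eq_zero (hT _ h) (hY P'))

end Bimodules

theorem theorem4p3 {H₁ H₂ K₁ K₂ : Type*}
    [NormedAddCommGroup H₁] [InnerProductSpace ℂ H₁] [CompleteSpace H₁]
    [NormedAddCommGroup H₂] [InnerProductSpace ℂ H₂] [CompleteSpace H₂]
    [NormedAddCommGroup K₁] [InnerProductSpace ℂ K₁] [CompleteSpace K₁]
    [NormedAddCommGroup K₂] [InnerProductSpace ℂ K₂] [CompleteSpace K₂]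
    (S₁ : Set (Proj H₁ × Proj H₂)) (S₂ : Set (Proj K₁ × Proj K₂))
    (hS₁ : IsStronglyClosedCommBilattice S₁) (hS₂ : IsStronglyClosedCommBilattice S₂)
    (φ : leftSet S₁ → leftSet S₂) (ψ : rightSet S₁ → rightSet S₂)
    (hom : IsBilatticeHom φ ψ) (hφ : Continuous φ) (hψ : Continuous ψ)
    (honto : IsOntoBilattice φ ψ) :
    (opMul (spaceW₂ ψ) (opMul (bilatticeSpace S₂) (spaceV₁ φ)) ⊆ bilatticeSpace S₁ ∧
      bilatticeSpace S₂ = wkSpan (opMul (spaceV₂ ψ) (opMul (bilatticeSpace S₁) (spaceW₁ φ)))) ∧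
    (opMul (spaceW₁ φ) (spaceV₁ φ) ⊆ Alg (leftSet S₁) ∧
      wkSpan (opMul (spaceV₁ φ) (spaceW₁ φ)) = Alg (leftSet S₂)) ∧
    (opMul (spaceW₂ ψ) (spaceV₂ ψ) ⊆ opAdj (Alg (rightSet S₁)) ∧
      wkSpan (opMul (spaceV₂ ψ) (spaceW₂ ψ)) = opAdj (Alg (rightSet S₂))) := by
  have happrox₁ : IsApproximable (Submodule.span ℂ (opMul (spaceV₁ φ) (spaceW₁ φ))) Set.univ :=
    (isApproximable_of_isCSLHom hS₁.isClosed_leftSet ⟨_, hS₁.bot_bot_mem⟩ ⟨_, hS₁.top_bot_mem⟩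
      hS₁.supClosed_leftSet hS₁.infClosed_leftSet hS₁.comm_left hS₂.comm_left hom.left).1
  have happrox₂ : IsApproximable (Submodule.span ℂ (opMul (spaceV₂ ψ) (spaceW₂ ψ))) Set.univ :=
    (isApproximable_of_isCSLHom hS₁.isClosed_rightSet ⟨_, hS₁.bot_bot_mem⟩ ⟨_, hS₁.bot_top_mem⟩
      hS₁.supClosed_rightSet hS₁.infClosed_rightSet hS₁.comm_right hS₂.comm_right hom.right).2
  have hφs : ∀ P ∈ leftSet S₂, ∃ P' : leftSet S₁, (φ P' : Proj K₁) = P := by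
    rintro P ⟨Q, hPQ⟩
    obtain ⟨P', _, _, h, _⟩ := honto _ hPQ
    exact ⟨P', h⟩
  have hψs : ∀ Q ∈ rightSet S₂, ∃ Q' : rightSet S₁, (ψ Q' : Proj K₂) = Q := by
    rintro Q ⟨P, hPQ⟩
    obtain ⟨_, Q', _, _, h⟩ := honto _ hPQ
    exact ⟨Q', h⟩
  refine ⟨⟨?_, Set.Subset.antisymm (fun T hT => ?_) fun T hT => ?_⟩,
    ⟨?_, Set.Subset.antisymm (fun T hT => ?_) fun T hT => ?_⟩,
    ⟨?_, Set.Subset.antisymm (fun T hT => ?_) fun T hT => ?_⟩⟩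
  · rintro _ ⟨X, hX, _, ⟨T, hT, Y, hY, rfl⟩, rfl⟩
    exact comp_mem_bilatticeSpace_left hom hX hT hY
  -- For `A = X Y` and `B = X' Y'` the product regroups as `X (Y T X') Y'`, and `Y T X'` lies in
  -- `bilatticeSpace S₁` by the inclusion already proved.
  · refine happrox₂.mem_wkSpan_comp happrox₁ fun A hA B hB => ?_
    refine comp_mem_span_opMul (fun X hX Y hY => ?_) hA
    have h := comp_mem_span_opMul' (T := X ∘L Y ∘L T)
      (𝒳 := opMul (spaceV₂ ψ) (opMul (bilatticeSpace S₁) (spaceW₁ φ)))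
      (fun X' hX' Y' hY' => Submodule.subset_span
        ⟨X, hX, _, ⟨_, comp_mem_bilatticeSpace_left hom hY hT hX', Y', hY', rfl⟩, rfl⟩) hB
    exact h
  · refine fun p hp => corner_eq_zero_of_mem_wkSpan p.2.op p.1.op ?_ hT
    rintro _ ⟨X, hX, _, ⟨T, hT, Y, hY, rfl⟩, rfl⟩
    exact comp_mem_bilatticeSpace_right honto hX hT hY p hp
  · rintro _ ⟨X, hX, Y, hY, rfl⟩
    exact mem_Alg_iff.mpr fun P hP => (φ ⟨P, hP⟩ : Proj K₁).corner_comp_eq_zero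
      (hX ⟨P, hP⟩) (hY ⟨P, hP⟩)
  · refine mem_Alg_iff.mpr fun P hP => corner_eq_zero_of_mem_wkSpan P.perp P.op ?_ hT
    rintro _ ⟨X, hX, Y, hY, rfl⟩
    obtain ⟨P', rfl⟩ := hφs P hP
    exact (P' : Proj H₁).corner_comp_eq_zero (hX P') (hY P')
  · refine happrox₁.mem_wkSpan fun A hA => comp_mem_span_opMul (fun X hX Y hY => ?_) hA
    -- The algebra acts on `spaceW₁ φ` from the right, so `T` is absorbed into the second factor.
    refine Submodule.subset_span ⟨X, hX, Y ∘L T, fun P => ?_, rfl⟩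
    exact (φ P : Proj K₁).corner_comp_eq_zero (hY P) (mem_Alg_iff.mp hT _ (φ P).2)
  · rintro _ ⟨X, hX, Y, hY, rfl⟩
    exact mem_opAdj_Alg_iff.mpr fun Q hQ => (ψ ⟨Q, hQ⟩ : Proj K₂).corner_comp_eq_zero'
      (hX ⟨Q, hQ⟩) (hY ⟨Q, hQ⟩)
  · refine mem_opAdj_Alg_iff.mpr fun Q hQ => corner_eq_zero_of_mem_wkSpan Q.op Q.perp ?_ hT
    rintro _ ⟨X, hX, Y, hY, rfl⟩
    obtain ⟨Q', rfl⟩ := hψs Q hQ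
    exact (Q' : Proj H₂).corner_comp_eq_zero' (hX Q') (hY Q')
  · refine happrox₂.mem_wkSpan fun A hA => comp_mem_span_opMul (fun X hX Y hY => ?_) hA
    refine Submodule.subset_span ⟨X, hX, Y ∘L T, fun Q => ?_, rfl⟩
    exact (ψ Q : Proj K₂).corner_comp_eq_zero' (hY Q) (mem_opAdj_Alg_iff.mp hT _ (ψ Q).2)
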